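/- For a finite simple graph $G$ let $\lambda_1(G)$ denote the largest eigenvalue of its adjacency matrix (the spectral radius of $G$). For an integer $n\ge 4$ define a graph $H_n$ with vertex set $\{0,1,\dots,n-1\}$ as follows. If $n\equiv 1,2\pmod 4$, put $c=4$ and let $E_0$ be the set of the seven pairs $\{0,1\},\{0,2\},\{0,3\},\{1,2\},\{1,3\},\{2,4\},\{3,4\}$ (that is, $K_4$ minus the edge $\{2,3\}$, with the ends of the missing edge both joined to the vertex $4$). If $n\equiv 0,3\pmod 4$, put $c=6$ and let $E_0$ be the set of the ten pairs $\{0,1\},\{0,2\},\{0,3\},\{1,2\},\{1,3\},\{2,4\},\{3,5\},\{4,5\},\{4,6\},\{5,6\}$ (that is, $K_4$ minus the edge $\{2,3\}$, and a triangle on $4,5,6$, linked by $\{2,4\}$ and $\{3,5\}$). The edges of $H_n$ are those pairs contained in $\{0,\dots,n-1\}$ that belong to $E_0$ or, for some integer $k\ge 0$ and $b=c+4k$, are one of $$\{b,b+1\},\ \{b+1,b+2\},\ \{b+1,b+3\},\ \{b+2,b+3\},\ \{b+2,b+4\},\ \{b+3,b+4\}$$ (that is, an edge from $b$ to $b+1$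 followed by a copy of $K_4$ minus the edge $\{b+1,b+4\}$ on $b+1,\dots,b+4$). So for $n\ge 5$ the graph $H_n$ is a path-like chain: the head $E_0$, then copies of $K_4$ minus an edge, consecutive pieces being joined by an edge, and, if $n$ is even, one pendant vertex attached at the end of the chain; $H_4$ is $K_4$ minus an edge. **Theorem.** Let $n\ge 4$. Then $H_n$ is a connected nonregular graph with $n$ vertices and maximum degree $3$, and it is, up to isomorphism, the unique graph attaining the maximum spectral radius among all such graphs: for every connected nonregular graph $G$ with $n$ vertices and maximum degree $3$ one has $\lambda_1(G)\le\lambda_1(H_n)$, with equality if and only if $G\cong H_n$. -/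

import Mathlib

/-- The spectral radius `λ₁(G)` of a finite graph: the largest eigenvalue of its adjacency
matrix. -/
noncomputable def graphSpectralRadius {V : Type*} [Fintype V] (G : SimpleGraph V) : ℝ := by
  classical
  exact sSup {μ : ℝ | Module.End.HasEigenvalue (Matrix.toLin' (G.adjMatrix ℝ)) μ}

/-- On a nonempty vertex set the supremum in `graphSpectralRadius` is a maximum: it really is the
largest eigenvalue. -/
theorem graphSpectralRadius_isGreatest {V : Type*} [Fintype V] [Nonempty V] [DecidableEq V]
    (G : SimpleGraph V) [DecidableRel G.Adj] :
    IsGreatest {μ : ℝ | Module.End.HasEigenvalue (Matrix.toLin' (G.adjMatrix ℝ)) μ}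
      (graphSpectralRadius G) := by
  have key : graphSpectralRadius G =
      sSup {μ : ℝ | Module.End.HasEigenvalue (Matrix.toLin' (G.adjMatrix ℝ)) μ} := by
    unfold graphSpectralRadius
    congr!
  have hA : (G.adjMatrix ℝ).IsHermitian := by
    rw [Matrix.IsHermitian, Matrix.conjTranspose_eq_transpose_of_trivial]
    exact G.transpose_adjMatrix
  have hset : {μ : ℝ | Module.End.HasEigenvalue (Matrix.toLin' (G.adjMatrix ℝ)) μ} =
      Set.range hA.eigenvalues := by
    rw [← hA.spectrum_real_eq_range_eigenvalues]
    ext μ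
    rw [Set.mem_ofPred_eq, Module.End.hasEigenvalue_iff_mem_spectrum, Matrix.spectrum_toLin']
  rw [key, hset]
  exact IsCompact.isGreatest_sSup (Set.finite_range _).isCompact (Set.range_nonempty _)

/-- The competing graphs: connected, not regular, with maximum degree `Δ`. -/
def IsConnectedNonregular {V : Type*} [Fintype V] (Δ : ℕ) (G : SimpleGraph V) : Prop := by
  classical
  exact G.Connected ∧ (¬ ∃ d : ℕ, G.IsRegularOfDegree d) ∧ G.maxDegree = Δ

/-- The head of the extremal graph when `n ≡ 1, 2 (mod 4)`: five vertices `0, …, 4`, namely `K₄`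
minus the edge `{2, 3}`, with both ends of the missing edge joined to the vertex `4`. -/
def shortHead : List (ℕ × ℕ) :=
  [(0, 1), (0, 2), (0, 3), (1, 2), (1, 3), (2, 4), (3, 4)]

/-- The head of the extremal graph when `n ≡ 0, 3 (mod 4)`: seven vertices `0, …, 6`, namely `K₄`
minus the edge `{2, 3}` on `0, 1, 2, 3` and a triangle on `4, 5, 6`, joined by the edges
`{2, 4}` and `{3, 5}`. -/
def longHead : List (ℕ × ℕ) :=
  [(0, 1), (0, 2), (0, 3), (1, 2), (1, 3), (2, 4), (3, 5), (4, 5), (4, 6), (5, 6)]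

/-- The edges contributed by one block following the vertex `b`: the edge `{b, b + 1}`, and `K₄`
minus the edge `{b + 1, b + 4}` on the vertices `b + 1, b + 2, b + 3, b + 4`. -/
def blockEdges (b : ℕ) : List (ℕ × ℕ) :=
  [(b, b + 1), (b + 1, b + 2), (b + 1, b + 3), (b + 2, b + 3), (b + 2, b + 4), (b + 3, b + 4)]

/-- The path-like graph on the vertices `0, …, n - 1`, numbered from left to right: the head,
followed by a chain of blocks `K₄` minus an edge. The last vertex of the head is `4`, resp. `6`,
and the `k`-th block (`k = 0, 1, …`) follows the vertex `4 + 4 * k`, resp. `6 + 4 * k`.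
For `n` odd the chain ends with a complete block (or with the head, if `n = 5` or `n = 7`).
For `n` even, `n ≥ 6`, the vertex `n - 1` is a pendant vertex attached to the last vertex of the
chain. For `n = 4` only the vertices `0, 1, 2, 3` remain and the graph is `K₄` minus an edge. -/
def extremalGraph (n : ℕ) : SimpleGraph (Fin n) :=
  SimpleGraph.fromRel fun i j : Fin n =>
    if n % 4 = 1 ∨ n % 4 = 2 then
      ((i : ℕ), (j : ℕ)) ∈ shortHead ∨ ∃ k : ℕ, ((i : ℕ), (j : ℕ)) ∈ blockEdges (4 + 4 * k)
    else
      ((i : ℕ), (j : ℕ)) ∈ longHead ∨ ∃ k : ℕ, ((i : ℕ), (j : ℕ)) ∈ blockEdges (6 + 4 * k)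

/-!
Let `λ₁` of the extremal chain be `3 - μ`, and let `G` be a competitor with `λ₁(G) ≥ 3 - μ`. It is
shown that `G` is isomorphic to the chain (`nonempty_iso_extremalGraph`); both the inequality and
the uniqueness follow at once.

Number the vertices of `G` so that its Perron vector `f` is decreasing, and put `f = 0` beyond the
last vertex. Missing degree is thought of as edges to a grounded vertex, so every vertex has degree
three and `cut p` is the number of edges that leave the first `p` vertices. Summing
`(3 - μ) f ≤ A f` over the first `p` vertices shows that the flux through this cut, the sum of the
drops of `f` along its edges, is at most `μ (f 0 + ⋯ + f (p - 1))`
(`IsSortedSubsolution.flux_ge`). Cuts have the parity of their index, connectedness and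
nonregularity make them positive, and two consecutive cuts of odd index are never both bridges
(`IsSubcubicGraph.three_le_cut_of_cut_eq_one`).

Group the vertices into pairs `{p, p + 1}` with `p` even and follow the ratio of the current value
of `f` to the sum of `f` so far. A cut of even index lowers it by at most `μ / 2`. An unbridged pair
acts by the Möbius map `rungMap` on the ratio formed with the mean value of the pair, and a bridged
pair acts at worst by the map `bridgeMap`. Exchanging a bridged pair with a later unbridged pair
lowers the ratio (`bridgeMap_rungMap_lt`), and bridged pairs cannot be adjacent, so over every two
pairs the ratio drops by no more than in the chain, where every other pair is bridged
(`IsSortedSubsolution.block_step`). The Perron vector of the chain satisfies all these estimates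
with equality (`IsChainFlux.isChainRatio`). At the last vertex the ratio of `G` cannot exceed that of
the chain, so equality holds throughout. For an odd number of vertices `G` might gain if its last
bridged pair comes too early, so that the order of the last two pairs cannot be exchanged; but its
bridges are then out of phase with those of the chain, and this has kept it ahead by `μ / 4`, which
is more than it can gain (`IsSortedSubsolution.block_step_advantage`, `lt_bridgeMap_of_advantage`).
The single case `n = 7` leaves no room for this advantage and is settled by `lt_bridgeMap_of_start`.

Hence all even cuts of `G` have size two and its bridges are those of the chain
(`IsSortedSubsolution.hasChainCuts`). Counting backward neighbours then recovers every edge, up to a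
permutation of the first four vertices
(`IsSubcubicGraph.exists_perm_extremalGraph_adj_iff`).
-/


/-! ### Perron vectors -/

section Perron

variable {V : Type*} [Fintype V] [DecidableEq V] (G : SimpleGraph V) [DecidableRel G.Adj]

theorem graphSpectralRadius_posSemidef [Nonempty V] :
    (graphSpectralRadius G • (1 : Matrix V V ℝ) - G.adjMatrix ℝ).PosSemidef := by
  have hA : (G.adjMatrix ℝ).IsHermitian := by
    rw [Matrix.IsHermitian, Matrix.conjTranspose_eq_transpose_of_trivial]
    exact G.transpose_adjMatrix
  have hH : (graphSpectralRadius G • (1 : Matrix V V ℝ) - G.adjMatrix ℝ).IsHermitian := by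
    refine Matrix.IsHermitian.sub ?_ hA
    rw [Matrix.IsHermitian, Matrix.conjTranspose_eq_transpose_of_trivial]
    simp
  rw [hH.posSemidef_iff_eigenvalues_nonneg]
  intro i
  have h1 := hH.mulVec_eigenvectorBasis i
  have hne : (hH.eigenvectorBasis i).ofLp ≠ 0 := by
    intro h
    have := hH.eigenvectorBasis.orthonormal.ne_zero i
    exact this (by ext j; exact congrFun h j)
  have h2 : Module.End.HasEigenvalue (Matrix.toLin' (G.adjMatrix ℝ))
      (graphSpectralRadius G - hH.eigenvalues i) := by
    refine Module.End.hasEigenvalue_of_hasEigenvector (x := (hH.eigenvectorBasis i).ofLp) ⟨?_, hne⟩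
    rw [Module.End.mem_eigenspace_iff, Matrix.toLin'_apply]
    rw [Matrix.sub_mulVec, Matrix.smul_mulVec, Matrix.one_mulVec] at h1
    rw [sub_smul, ← h1]
    simp
  have h3 := (graphSpectralRadius_isGreatest G).2 h2
  simp only [Pi.zero_apply]
  linarith

/-- The Rayleigh bound for the spectral radius. -/
theorem dotProduct_adjMatrix_mulVec_le [Nonempty V] (x : V → ℝ) :
    x ⬝ᵥ (G.adjMatrix ℝ).mulVec x ≤ graphSpectralRadius G * (x ⬝ᵥ x) := by
  have h := (graphSpectralRadius_posSemidef G).dotProduct_mulVec_nonneg x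
  rw [Matrix.sub_mulVec, Matrix.smul_mulVec, Matrix.one_mulVec, dotProduct_sub,
    dotProduct_smul] at h
  simp only [star_trivial, smul_eq_mul] at h
  linarith

/-- A connected graph has a positive eigenvector for its spectral radius. The absolute value of any
top eigenvector maximises the Rayleigh quotient as well, so it is again an eigenvector, and its
zero set is closed under adjacency. -/
theorem exists_perron_vector (hG : G.Connected) :
    ∃ f : V → ℝ, (∀ v, 0 < f v) ∧
      ∀ v, ∑ u, (if G.Adj v u then f u else 0) = graphSpectralRadius G * f v := by
  have := hG.nonempty
  obtain ⟨x, hx, hx0⟩ := (graphSpectralRadius_isGreatest G).1.exists_hasEigenvector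
  rw [Module.End.mem_eigenspace_iff, Matrix.toLin'_apply] at hx
  set w : V → ℝ := fun v => |x v| with hw
  have hww : w ⬝ᵥ w = x ⬝ᵥ x := by
    simp [dotProduct, hw]
  have hxx : x ⬝ᵥ (G.adjMatrix ℝ).mulVec x = graphSpectralRadius G * (x ⬝ᵥ x) := by
    rw [hx, dotProduct_smul, smul_eq_mul]
  have hle : x ⬝ᵥ (G.adjMatrix ℝ).mulVec x ≤ w ⬝ᵥ (G.adjMatrix ℝ).mulVec w := by
    simp only [dotProduct, Matrix.mulVec, Finset.mul_sum]
    refine Finset.sum_le_sum fun i _ => Finset.sum_le_sum fun j _ => ?_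
    rw [SimpleGraph.adjMatrix_apply]
    split_ifs
    · simp only [one_mul, hw, ← abs_mul]
      exact le_abs_self _
    · simp
  have hzero : star w ⬝ᵥ (graphSpectralRadius G • (1 : Matrix V V ℝ) - G.adjMatrix ℝ).mulVec w
      = 0 := by
    have h1 := dotProduct_adjMatrix_mulVec_le G w
    rw [Matrix.sub_mulVec, Matrix.smul_mulVec, Matrix.one_mulVec, dotProduct_sub,
      dotProduct_smul]
    simp only [star_trivial, smul_eq_mul]
    rw [hww] at h1 ⊢
    linarith
  have hker := ((graphSpectralRadius_posSemidef G).dotProduct_mulVec_zero_iff w).1 hzero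
  have heq : ∀ v, ∑ u, (if G.Adj v u then w u else 0) = graphSpectralRadius G * w v := by
    intro v
    have := congrFun hker v
    rw [Matrix.sub_mulVec, Matrix.smul_mulVec, Matrix.one_mulVec] at this
    simp only [Pi.sub_apply, Pi.smul_apply, smul_eq_mul, Pi.zero_apply, Matrix.mulVec, dotProduct,
      SimpleGraph.adjMatrix_apply, ite_mul, one_mul, zero_mul] at this
    linarith
  refine ⟨w, ?_, heq⟩
  by_contra hcon
  push Not at hcon
  obtain ⟨v, hv⟩ := hcon
  have hv0 : w v = 0 := le_antisymm hv (abs_nonneg _)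
  have hstep : ∀ a b, G.Adj a b → w a = 0 → w b = 0 := by
    intro a b hab ha
    have h := heq a
    rw [ha, mul_zero, Finset.sum_eq_zero_iff_of_nonneg
      (fun u _ => by split_ifs; exacts [abs_nonneg _, le_rfl])] at h
    simpa [hab] using h b (Finset.mem_univ b)
  have hall : ∀ u, w u = 0 := by
    intro u
    obtain ⟨p⟩ := hG.preconnected v u
    clear hv
    induction p with
    | nil => exact hv0
    | cons hadj _ ih => exact ih (hstep _ _ hadj hv0)
  exact hx0 (funext fun u => abs_eq_zero.1 (hall u))

end Perron

theorem hasEigenvalue_adjMatrix_of_iso {V W : Type*} [Fintype V] [Fintype W] [DecidableEq V]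
    [DecidableEq W] {G : SimpleGraph V} {H : SimpleGraph W} [DecidableRel G.Adj]
    [DecidableRel H.Adj] (e : G ≃g H) {μ : ℝ}
    (h : Module.End.HasEigenvalue (Matrix.toLin' (H.adjMatrix ℝ)) μ) :
    Module.End.HasEigenvalue (Matrix.toLin' (G.adjMatrix ℝ)) μ := by
  obtain ⟨x, hx, hx0⟩ := h.exists_hasEigenvector
  rw [Module.End.mem_eigenspace_iff, Matrix.toLin'_apply] at hx
  refine Module.End.hasEigenvalue_of_hasEigenvector (x := x ∘ e) ⟨?_, ?_⟩
  · rw [Module.End.mem_eigenspace_iff, Matrix.toLin'_apply]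
    ext v
    have := congrFun hx (e v)
    simp only [Matrix.mulVec, dotProduct, SimpleGraph.adjMatrix_apply, Pi.smul_apply,
      Function.comp_apply] at this ⊢
    rw [← this, ← Equiv.sum_comp e.toEquiv]
    refine Finset.sum_congr rfl fun u _ => ?_
    have : H.Adj (e v) (e.toEquiv u) ↔ G.Adj v u := e.map_adj_iff
    simp only [this]
    rfl
  · intro h0
    refine hx0 (funext fun w => ?_)
    have := congrFun h0 (e.symm w)
    simpa using this

theorem graphSpectralRadius_congr {V W : Type*} [Fintype V] [Fintype W] {G : SimpleGraph V}
    {H : SimpleGraph W} (e : G ≃g H) : graphSpectralRadius G = graphSpectralRadius H := by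
  classical
  unfold graphSpectralRadius
  congr 1
  ext μ
  exact ⟨fun h => hasEigenvalue_adjMatrix_of_iso e.symm h,
    fun h => hasEigenvalue_adjMatrix_of_iso e h⟩

/-! ### Cuts of a subcubic graph along an ordering -/

/-- A graph on the vertices `0, …, n - 1` with all degrees at most `3`, encoded by its adjacency
function `A : ℕ → ℕ → ℤ` with values in `{0, 1}`. -/
structure IsSubcubicGraph (n : ℕ) (A : ℕ → ℕ → ℤ) : Prop where
  symm : ∀ i j, A i j = A j i
  zero_or_one : ∀ i j, A i j = 0 ∨ A i j = 1
  diag : ∀ i, A i i = 0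
  supp : ∀ i j, n ≤ j → A i j = 0
  deg_le : ∀ i, ∑ j ∈ Finset.range n, A i j ≤ 3

/-- A graph on the vertices `0, …, n - 1` with all degrees at most `3` such that no initial segment
`{0, …, p - 1}` is closed under adjacency with all its degrees equal to `3`; this is what
connectedness and nonregularity contribute. -/
structure IsSubcubicNetwork (n : ℕ) (A : ℕ → ℕ → ℤ) : Prop extends IsSubcubicGraph n A where
  exists_open : ∀ p, 1 ≤ p → p ≤ n → ∃ i < p, ∑ j ∈ Finset.range p, A i j ≠ 3

/-- The number of edges leaving the initial segment `{0, …, p - 1}`, where every vertex of degree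
`d < 3` is thought of as having `3 - d` further edges to a grounded vertex. -/
def cut (A : ℕ → ℕ → ℤ) (p : ℕ) : ℤ :=
  ∑ i ∈ Finset.range p, (3 - ∑ j ∈ Finset.range p, A i j)

/-- The number of neighbours of the vertex `i` in the initial segment `{0, …, p - 1}`. -/
def nbrsBelow (A : ℕ → ℕ → ℤ) (p i : ℕ) : ℤ := ∑ j ∈ Finset.range p, A i j

namespace IsSubcubicGraph

variable {n : ℕ} {A : ℕ → ℕ → ℤ} (hA : IsSubcubicGraph n A)
include hA

theorem nonneg (i j : ℕ) : 0 ≤ A i j := by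
  rcases hA.zero_or_one i j with h | h <;> omega

theorem le_one (i j : ℕ) : A i j ≤ 1 := by
  rcases hA.zero_or_one i j with h | h <;> omega

theorem nbrsBelow_nonneg (p i : ℕ) : 0 ≤ nbrsBelow A p i :=
  Finset.sum_nonneg fun _ _ => hA.nonneg _ _

theorem nbrsBelow_mono {p q : ℕ} (h : p ≤ q) (i : ℕ) : nbrsBelow A p i ≤ nbrsBelow A q i :=
  Finset.sum_le_sum_of_subset_of_nonneg (Finset.range_mono h) fun _ _ _ => hA.nonneg _ _

theorem nbrsBelow_le_three {p : ℕ} (i : ℕ) : nbrsBelow A p i ≤ 3 := by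
  rcases le_total p n with h | h
  · exact (hA.nbrsBelow_mono h i).trans (hA.deg_le i)
  · have : nbrsBelow A p i = nbrsBelow A n i := by
      refine (Finset.sum_subset (Finset.range_mono h) fun j _ hj => hA.supp i j ?_).symm
      simpa using hj
    rw [this]
    exact hA.deg_le i

theorem nbrsBelow_le (p i : ℕ) : nbrsBelow A p i ≤ p := by
  refine (Finset.sum_le_card_nsmul _ _ 1 fun j _ => hA.le_one i j).trans ?_
  simp

end IsSubcubicGraph

theorem nbrsBelow_succ (A : ℕ → ℕ → ℤ) (p i : ℕ) :
    nbrsBelow A (p + 1) i = nbrsBelow A p i + A i p :=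
  Finset.sum_range_succ _ _

theorem cut_eq (A : ℕ → ℕ → ℤ) (p : ℕ) :
    cut A p = ∑ i ∈ Finset.range p, (3 - nbrsBelow A p i) := rfl

namespace IsSubcubicGraph

variable {n : ℕ} {A : ℕ → ℕ → ℤ} (hA : IsSubcubicGraph n A)
include hA

theorem cut_succ (p : ℕ) : cut A (p + 1) = cut A p + 3 - 2 * nbrsBelow A p p := by
  rw [cut_eq, cut_eq, Finset.sum_range_succ]
  have h1 : ∑ i ∈ Finset.range p, (3 - nbrsBelow A (p + 1) i)
      = ∑ i ∈ Finset.range p, (3 - nbrsBelow A p i) - nbrsBelow A p p := by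
    rw [nbrsBelow, ← Finset.sum_sub_distrib]
    refine Finset.sum_congr rfl fun i _ => ?_
    rw [nbrsBelow_succ, hA.symm p i]
    ring
  rw [h1, nbrsBelow_succ, hA.diag]
  ring

theorem cut_parity (p : ℕ) : cut A p % 2 = (p : ℤ) % 2 := by
  induction p with
  | zero => simp [cut]
  | succ p ih => have := hA.cut_succ p; push_cast; omega

/-- The edges from an initial segment to the later vertices are among those counted by `cut`. -/
theorem sum_nbrsBelow_le_cut (p q : ℕ) :
    ∑ j ∈ Finset.Ico p q, nbrsBelow A p j ≤ cut A p := by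
  have h1 : ∑ j ∈ Finset.Ico p q, nbrsBelow A p j
      = ∑ i ∈ Finset.range p, ∑ j ∈ Finset.Ico p q, A i j := by
    simp only [nbrsBelow]
    rw [Finset.sum_comm]
    exact Finset.sum_congr rfl fun i _ => Finset.sum_congr rfl fun j _ => hA.symm j i
  rw [h1, cut_eq]
  refine Finset.sum_le_sum fun i _ => ?_
  rcases le_total p q with hpq | hpq
  · have h2 := Finset.sum_range_add_sum_Ico (A i) hpq
    have h3 := hA.nbrsBelow_le_three (p := q) i
    simp only [nbrsBelow] at h3 ⊢
    omega
  · rw [Finset.Ico_eq_empty_of_le hpq, Finset.sum_empty]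
    have h3 := hA.nbrsBelow_le_three (p := p) i
    omega

theorem nbrsBelow_add_le_cut (p : ℕ) :
    nbrsBelow A p p + nbrsBelow A p (p + 1) ≤ cut A p := by
  have h := hA.sum_nbrsBelow_le_cut p (p + 2)
  rwa [Finset.sum_Ico_eq_sum_range, show p + 2 - p = 2 by omega, Finset.sum_range_succ,
    Finset.sum_range_one] at h

/-- Two consecutive cuts of odd index cannot both be bridges. -/
theorem three_le_cut_of_cut_eq_one {p : ℕ} (h : cut A p = 1) : 3 ≤ cut A (p + 2) := by
  have h1 := hA.cut_succ p
  have h2 := hA.cut_succ (p + 1)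
  have h3 := hA.nbrsBelow_add_le_cut p
  have h4 := nbrsBelow_succ A p (p + 1)
  have h5 := hA.le_one (p + 1) p
  rw [show p + 2 = p + 1 + 1 from rfl]
  omega

theorem cut_one : cut A 1 = 3 := by
  have := hA.cut_succ 0
  simpa [nbrsBelow, cut] using this

theorem four_le_cut_two : 4 ≤ cut A 2 := by
  have h := hA.cut_succ 1
  have h1 := hA.cut_one
  have h2 := hA.nbrsBelow_le 1 1
  norm_num at h h2
  omega

theorem three_le_cut_three : 3 ≤ cut A 3 := by
  have h := hA.cut_succ 1
  have h' := hA.cut_succ 2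
  have h1 := hA.cut_one
  have h2 := hA.nbrsBelow_le 1 1
  have h3 := hA.nbrsBelow_le 2 2
  norm_num at h h' h2 h3
  omega

end IsSubcubicGraph

namespace IsSubcubicNetwork

variable {n : ℕ} {A : ℕ → ℕ → ℤ} (hA : IsSubcubicNetwork n A)
include hA

theorem cut_pos {p : ℕ} (h1 : 1 ≤ p) (hp : p ≤ n) : 1 ≤ cut A p := by
  obtain ⟨i, hi, hne⟩ := hA.exists_open p h1 hp
  have h := Finset.single_le_sum (f := fun i => 3 - nbrsBelow A p i)
    (fun j _ => by have := hA.nbrsBelow_le_three (p := p) j; omega)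
    (Finset.mem_range.2 hi)
  have h2 := hA.nbrsBelow_le_three (p := p) i
  have h3 : nbrsBelow A p i ≠ 3 := hne
  rw [cut_eq]
  omega

theorem two_le_cut_of_even {p : ℕ} (h1 : 1 ≤ p) (hp : p ≤ n) (he : p % 2 = 0) : 2 ≤ cut A p := by
  have := hA.cut_pos h1 hp
  have := hA.cut_parity p
  omega

/-- Beyond the last vertex every further vertex is isolated. -/
theorem three_le_cut_succ_of_le {p : ℕ} (hp : p = n) (h1 : 1 ≤ p) : 3 ≤ cut A (p + 1) := by
  have h := hA.cut_succ p
  have : nbrsBelow A p p = 0 := by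
    refine Finset.sum_eq_zero fun j _ => ?_
    rw [hA.symm]
    exact hA.supp _ _ hp.ge
  have := hA.cut_pos h1 hp.le
  omega

theorem cut_eq_one_or_three_le {p : ℕ} (hp : p ≤ n) (h1 : p % 2 = 1) :
    cut A p = 1 ∨ 3 ≤ cut A p := by
  have := hA.cut_pos (by omega) hp
  have := hA.cut_parity p
  omega

end IsSubcubicNetwork

/-! ### The flux of a decreasing function through a cut -/

/-- A positive decreasing function on the network `A` on which the adjacency operator acts by at
least `3 - μ`, extended by `0` beyond the last vertex. -/
structure IsSortedSubsolution (n : ℕ) (A : ℕ → ℕ → ℤ) (μ : ℝ) (f : ℕ → ℝ) : Prop where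
  antitone : Antitone f
  pos : ∀ i < n, 0 < f i
  zero : ∀ i, n ≤ i → f i = 0
  le_sum : ∀ i < n, (3 - μ) * f i ≤ ∑ j ∈ Finset.range n, (A i j : ℝ) * f j

/-- The sum of the first `p` values of `f`. -/
def partialSum (f : ℕ → ℝ) (p : ℕ) : ℝ := ∑ i ∈ Finset.range p, f i

theorem partialSum_succ (f : ℕ → ℝ) (p : ℕ) : partialSum f (p + 1) = partialSum f p + f p :=
  Finset.sum_range_succ _ _

theorem sum_mul_ge_of_antitone {f : ℕ → ℝ} (hf : Antitone f) (u : ℕ → ℝ) (k : ℕ)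
    (hu : ∀ i, 0 ≤ u i) :
    u (k + 1) * f (k + 1) + (∑ i ∈ Finset.range (k + 2), u i - u (k + 1)) * f k
      ≤ ∑ i ∈ Finset.range (k + 2), u i * f i := by
  rw [Finset.sum_range_succ _ (k + 1), Finset.sum_range_succ _ (k + 1)]
  have : (∑ i ∈ Finset.range (k + 1), u i) * f k ≤ ∑ i ∈ Finset.range (k + 1), u i * f i := by
    rw [Finset.sum_mul]
    refine Finset.sum_le_sum fun i hi => mul_le_mul_of_nonneg_left (hf ?_) (hu i)
    have := Finset.mem_range.1 hi
    omega
  linarith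

namespace IsSortedSubsolution

variable {n : ℕ} {A : ℕ → ℕ → ℤ} {μ : ℝ} {f : ℕ → ℝ} (hf : IsSortedSubsolution n A μ f)
include hf

theorem nonneg (i : ℕ) : 0 ≤ f i := by
  rcases lt_or_ge i n with h | h
  · exact (hf.pos i h).le
  · exact (hf.zero i h).ge

theorem partialSum_pos {p : ℕ} (h1 : 1 ≤ p) (hn : 1 ≤ n) : 0 < partialSum f p :=
  (hf.pos 0 (by omega)).trans_le
    (Finset.single_le_sum (f := f) (fun i _ => hf.nonneg i) (Finset.mem_range.2 (by omega)))

/-- The flux through the cut after the first `k + 2` vertices is at most `μ` times the sum of `f`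
over them. Every edge of the cut contributes the drop at the cut, and the edges that also cross the
preceding (following) cut contribute the drop there as well. -/
theorem flux_ge (hA : IsSubcubicNetwork n A) {k : ℕ} (hk : k + 2 ≤ n) :
    (cut A (k + 2) : ℝ) * (f (k + 1) - f (k + 2))
      + (cut A (k + 1) - nbrsBelow A (k + 1) (k + 1)) * (f k - f (k + 1))
      + (cut A (k + 2) - nbrsBelow A (k + 2) (k + 2)) * (f (k + 2) - f (k + 3))
      ≤ μ * partialSum f (k + 2) := by
  set p := k + 2 with hp
  have e1 : ∑ i ∈ Finset.range p, (3 - (nbrsBelow A p i : ℝ)) * f i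
        - ∑ j ∈ Finset.Ico p n, (nbrsBelow A p j : ℝ) * f j ≤ μ * partialSum f p := by
    have h1 : ∑ i ∈ Finset.range p, ∑ j ∈ Finset.range n, (A i j : ℝ) * f j
        = ∑ j ∈ Finset.range n, (nbrsBelow A p j : ℝ) * f j := by
      rw [Finset.sum_comm]
      refine Finset.sum_congr rfl fun j _ => ?_
      rw [nbrsBelow]
      push_cast
      rw [Finset.sum_mul]
      exact Finset.sum_congr rfl fun i _ => by rw [hA.symm]
    have h2 : ∑ i ∈ Finset.range p, (3 - μ) * f i
        ≤ ∑ i ∈ Finset.range p, ∑ j ∈ Finset.range n, (A i j : ℝ) * f j :=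
      Finset.sum_le_sum fun i hi => hf.le_sum i (by have := Finset.mem_range.1 hi; omega)
    rw [h1, ← Finset.sum_range_add_sum_Ico _ hk, ← Finset.mul_sum] at h2
    simp only [sub_mul, Finset.sum_sub_distrib, ← Finset.mul_sum, partialSum]
    linarith
  have hcut : (cut A p : ℝ) = ∑ i ∈ Finset.range p, (3 - (nbrsBelow A p i : ℝ)) := by
    rw [cut_eq]; push_cast; rfl
  have e2 : (3 - (nbrsBelow A p (k + 1) : ℝ)) * f (k + 1)
      + (cut A p - (3 - (nbrsBelow A p (k + 1) : ℝ))) * f k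
      ≤ ∑ i ∈ Finset.range p, (3 - (nbrsBelow A p i : ℝ)) * f i := by
    rw [hcut]
    refine sum_mul_ge_of_antitone hf.antitone (fun i => 3 - (nbrsBelow A p i : ℝ)) k fun i => ?_
    have : (nbrsBelow A p i : ℝ) ≤ 3 := by exact_mod_cast hA.nbrsBelow_le_three (p := p) i
    linarith
  have e3 : ∑ j ∈ Finset.Ico p n, (nbrsBelow A p j : ℝ) * f j
      ≤ nbrsBelow A p p * f p + (cut A p - nbrsBelow A p p) * f (p + 1) := by
    have hb : ∀ j, (0 : ℝ) ≤ nbrsBelow A p j := fun j => by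
      exact_mod_cast hA.nbrsBelow_nonneg p j
    have hc : ∑ j ∈ Finset.Ico p (max n (p + 1)), (nbrsBelow A p j : ℝ) ≤ cut A p := by
      exact_mod_cast hA.sum_nbrsBelow_le_cut p (max n (p + 1))
    have hle : ∑ j ∈ Finset.Ico p n, (nbrsBelow A p j : ℝ) * f j
        ≤ ∑ j ∈ Finset.Ico p (max n (p + 1)), (nbrsBelow A p j : ℝ) * f j :=
      Finset.sum_le_sum_of_subset_of_nonneg (Finset.Ico_subset_Ico_right (le_max_left _ _))
        fun j _ _ => mul_nonneg (hb j) (hf.nonneg j)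
    have hlt : p < max n (p + 1) := by omega
    rw [Finset.sum_eq_sum_Ico_succ_bot hlt] at hc hle
    have h3 : ∑ j ∈ Finset.Ico (p + 1) (max n (p + 1)), (nbrsBelow A p j : ℝ) * f j
        ≤ (∑ j ∈ Finset.Ico (p + 1) (max n (p + 1)), (nbrsBelow A p j : ℝ)) * f (p + 1) := by
      rw [Finset.sum_mul]
      refine Finset.sum_le_sum fun j hj => mul_le_mul_of_nonneg_left (hf.antitone ?_) (hb j)
      exact (Finset.mem_Ico.1 hj).1
    have h4 := mul_le_mul_of_nonneg_right
      (show ∑ j ∈ Finset.Ico (p + 1) (max n (p + 1)), (nbrsBelow A p j : ℝ)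
        ≤ cut A p - nbrsBelow A p p by linarith) (hf.nonneg (p + 1))
    linarith
  have e4 : (cut A p : ℝ) = cut A (k + 1) + 3 - 2 * nbrsBelow A (k + 1) (k + 1) := by
    exact_mod_cast hA.cut_succ (k + 1)
  have e5 : (nbrsBelow A p (k + 1) : ℝ) = nbrsBelow A (k + 1) (k + 1) := by
    have := nbrsBelow_succ A (k + 1) (k + 1)
    rw [hA.diag, add_zero] at this
    exact_mod_cast this
  rw [e5] at e2
  have e6 : (cut A p : ℝ) - (3 - (nbrsBelow A (k + 1) (k + 1) : ℝ))
      = cut A (k + 1) - nbrsBelow A (k + 1) (k + 1) := by rw [e4]; ring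
  rw [e6] at e2
  refine le_trans ?_ e1
  have e7 : ((3 : ℝ) - nbrsBelow A (k + 1) (k + 1))
      = cut A p - (cut A (k + 1) - nbrsBelow A (k + 1) (k + 1)) := by rw [e4]; ring
  rw [e7] at e2
  show _ + _ + _ * (f p - f (p + 1)) ≤ _
  nlinarith [e2, e3]

end IsSortedSubsolution

/-! ### Two Möbius maps -/

/-- The effect on the ratio (value of `f`) / (sum of `f` so far) of a rung, that is, of two further
vertices at equal value. -/
noncomputable def rungMap (x : ℝ) : ℝ := x / (1 + 2 * x)

/-- The effect on the ratio (value of `f`) / (sum of `f` so far) of two further vertices that are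
separated by a cut of size one, through which the whole flux has to pass. -/
noncomputable def bridgeMap (μ x : ℝ) : ℝ := ((1 - μ) * x - μ) / ((2 - μ) * x + (1 - μ))

theorem rungMap_le_rungMap {x y : ℝ} (hx : 0 ≤ x) (hxy : x ≤ y) : rungMap x ≤ rungMap y := by
  unfold rungMap
  rw [div_le_div_iff₀ (by linarith) (by linarith)]
  nlinarith

theorem le_of_rungMap_le {x y : ℝ} (hx : 0 ≤ x) (hy : 0 ≤ y) (h : rungMap x ≤ rungMap y) :
    x ≤ y := by
  unfold rungMap at h
  rw [div_le_div_iff₀ (by linarith) (by linarith)] at h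
  nlinarith

section

variable {μ x y : ℝ}

theorem bridgeMap_denom_pos (h1 : μ < 1) (hx : 0 ≤ x) : 0 < (2 - μ) * x + (1 - μ) := by
  nlinarith [mul_nonneg hx (show (0 : ℝ) ≤ 1 - μ by linarith)]

theorem bridgeMap_le_bridgeMap (h1 : μ < 1) (hx : 0 ≤ x) (hxy : x ≤ y) :
    bridgeMap μ x ≤ bridgeMap μ y := by
  unfold bridgeMap
  rw [div_le_div_iff₀ (bridgeMap_denom_pos h1 hx) (bridgeMap_denom_pos h1 (hx.trans hxy))]
  nlinarith

theorem le_of_bridgeMap_le (h1 : μ < 1) (hx : 0 ≤ x) (hy : 0 ≤ y)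
    (h : bridgeMap μ x ≤ bridgeMap μ y) : x ≤ y := by
  unfold bridgeMap at h
  rw [div_le_div_iff₀ (bridgeMap_denom_pos h1 hx) (bridgeMap_denom_pos h1 hy)] at h
  nlinarith

/-- A bridge lowers the ratio more than a rung does, by a definite amount. -/
theorem bridgeMap_add_le_rungMap (h0 : 0 < μ) (h1 : μ < 1) (hx : 0 ≤ x) :
    bridgeMap μ x + μ / 4 ≤ rungMap x := by
  unfold bridgeMap rungMap
  have hd := bridgeMap_denom_pos h1 hx
  rw [← sub_nonneg]
  have : x / (1 + 2 * x) - (((1 - μ) * x - μ) / ((2 - μ) * x + (1 - μ)) + μ / 4)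
      = μ * (4 * (1 + x) ^ 2 - (1 + 2 * x) * ((2 - μ) * x + (1 - μ)))
        / (4 * (1 + 2 * x) * ((2 - μ) * x + (1 - μ))) := by
    have h2 : (1 + 2 * x) ≠ 0 := by positivity
    have h3 := hd.ne'
    rw [eq_div_iff (by positivity)]
    linear_combination 4 * ((2 - μ) * x + (1 - μ)) * div_mul_cancel₀ x h2
      - 4 * (1 + 2 * x) * div_mul_cancel₀ ((1 - μ) * x - μ) h3
  rw [this]
  refine div_nonneg (mul_nonneg h0.le ?_) (by positivity)
  nlinarith [mul_nonneg hx hx, mul_nonneg hx h0.le, mul_nonneg (mul_nonneg hx hx) h0.le]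

/-- The rung followed by the bridge as a single Möbius map. -/
theorem bridgeMap_rungMap (hx : 0 < x) (hr : 0 < rungMap x - μ / 2) (h1 : μ < 1) :
    0 < (4 - μ) * (1 - μ) * x + (1 - 2 * μ + μ ^ 2 / 2) ∧
    bridgeMap μ (rungMap x - μ / 2)
      = ((1 - 4 * μ + μ ^ 2) * x - (3 * μ - μ ^ 2) / 2)
        / ((4 - μ) * (1 - μ) * x + (1 - 2 * μ + μ ^ 2 / 2)) := by
  have h2 : 0 < 1 + 2 * x := by linarith
  have hd := bridgeMap_denom_pos h1 hr.le
  have e1 : (2 - μ) * (rungMap x - μ / 2) + (1 - μ)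
      = ((4 - μ) * (1 - μ) * x + (1 - 2 * μ + μ ^ 2 / 2)) / (1 + 2 * x) := by
    unfold rungMap; field_simp; ring
  have e2 : (1 - μ) * (rungMap x - μ / 2) - μ
      = ((1 - 4 * μ + μ ^ 2) * x - (3 * μ - μ ^ 2) / 2) / (1 + 2 * x) := by
    unfold rungMap; field_simp; ring
  refine ⟨?_, ?_⟩
  · rw [e1] at hd
    exact (div_pos_iff_of_pos_right h2).1 hd
  · unfold bridgeMap
    rw [e1, e2, div_div_div_cancel_right₀ h2.ne']

/-- The bridge followed by the rung as a single Möbius map. -/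
theorem rungMap_bridgeMap (hx : 0 < x) (h1 : μ < 1) :
    rungMap (bridgeMap μ x - μ / 2)
      = ((1 - 2 * μ + μ ^ 2 / 2) * x - (3 * μ - μ ^ 2) / 2)
        / ((4 - μ) * (1 - μ) * x + (1 - 4 * μ + μ ^ 2)) := by
  have h2 := bridgeMap_denom_pos h1 hx.le
  have e1 : 1 + 2 * (bridgeMap μ x - μ / 2)
      = ((4 - μ) * (1 - μ) * x + (1 - 4 * μ + μ ^ 2)) / ((2 - μ) * x + (1 - μ)) := by
    unfold bridgeMap
    rw [eq_div_iff h2.ne']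
    linear_combination 2 * div_mul_cancel₀ ((1 - μ) * x - μ) h2.ne'
  have e2 : bridgeMap μ x - μ / 2
      = ((1 - 2 * μ + μ ^ 2 / 2) * x - (3 * μ - μ ^ 2) / 2) / ((2 - μ) * x + (1 - μ)) := by
    unfold bridgeMap
    rw [eq_div_iff h2.ne']
    linear_combination div_mul_cancel₀ ((1 - μ) * x - μ) h2.ne'
  unfold rungMap
  rw [e1, e2, div_div_div_cancel_right₀ h2.ne']

theorem bridgeMap_sub_pos (h0 : 0 < μ) (h1 : μ < 1) (hx : 0 < x)
    (hr : 0 < rungMap x - μ / 2) (hb : 0 < bridgeMap μ (rungMap x - μ / 2)) :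
    (3 * μ - μ ^ 2) / 2 < (1 - 4 * μ + μ ^ 2) * x ∧ 0 < bridgeMap μ x - μ / 2 := by
  obtain ⟨hd, e⟩ := bridgeMap_rungMap hx hr h1
  rw [e] at hb
  have hn := (div_pos_iff_of_pos_right hd).1 hb
  refine ⟨by linarith, ?_⟩
  have h2 := bridgeMap_denom_pos h1 hx.le
  have e2 : bridgeMap μ x - μ / 2
      = ((1 - 2 * μ + μ ^ 2 / 2) * x - (3 * μ - μ ^ 2) / 2) / ((2 - μ) * x + (1 - μ)) := by
    unfold bridgeMap
    rw [eq_div_iff h2.ne']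
    linear_combination div_mul_cancel₀ ((1 - μ) * x - μ) h2.ne'
  rw [e2]
  refine div_pos ?_ h2
  nlinarith [mul_pos hx h0, mul_pos (mul_pos hx h0) (show 0 < 1 - μ by linarith)]

/-- Moving a bridge to a later position lowers the ratio. -/
theorem bridgeMap_rungMap_lt (h0 : 0 < μ) (h1 : μ ≤ 1 / 2) (hx : 0 < x)
    (hr : 0 < rungMap x - μ / 2) (hb : 0 < bridgeMap μ (rungMap x - μ / 2)) :
    bridgeMap μ (rungMap x - μ / 2) < rungMap (bridgeMap μ x - μ / 2) := by
  obtain ⟨hn, -⟩ := bridgeMap_sub_pos h0 (by linarith) hx hr hb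
  obtain ⟨hd, e⟩ := bridgeMap_rungMap hx hr (by linarith)
  have hc : 0 < (4 - μ) * (1 - μ) := by nlinarith
  have hd0 : 0 < 1 - 4 * μ + μ ^ 2 := by
    by_contra hcon
    have := mul_nonneg (show 0 ≤ -(1 - 4 * μ + μ ^ 2) by linarith) hx.le
    nlinarith
  have hd' : 0 < (4 - μ) * (1 - μ) * x + (1 - 4 * μ + μ ^ 2) := by
    nlinarith [mul_pos hc hx]
  rw [e, rungMap_bridgeMap hx (by linarith), div_lt_div_iff₀ hd hd']
  have key : ((1 - 2 * μ + μ ^ 2 / 2) * x - (3 * μ - μ ^ 2) / 2)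
        * ((4 - μ) * (1 - μ) * x + (1 - 2 * μ + μ ^ 2 / 2))
      - ((1 - 4 * μ + μ ^ 2) * x - (3 * μ - μ ^ 2) / 2)
        * ((4 - μ) * (1 - μ) * x + (1 - 4 * μ + μ ^ 2))
      = (2 * μ - μ ^ 2 / 2) * ((4 - μ) * (1 - μ) * x ^ 2 + (1 - 2 * μ + μ ^ 2 / 2) * x
        + ((1 - 4 * μ + μ ^ 2) * x - (3 * μ - μ ^ 2) / 2)) := by ring
  have ha : 0 < 1 - 2 * μ + μ ^ 2 / 2 := by nlinarith
  have : 0 < (2 * μ - μ ^ 2 / 2) * ((4 - μ) * (1 - μ) * x ^ 2 + (1 - 2 * μ + μ ^ 2 / 2) * x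
        + ((1 - 4 * μ + μ ^ 2) * x - (3 * μ - μ ^ 2) / 2)) := by
    refine mul_pos (by nlinarith) ?_
    have := mul_pos hc (pow_pos hx 2)
    have := mul_pos ha hx
    linarith
  linarith

/-- An advantage of `μ / 4` over the extremal chain survives a bridge followed by a rung where the
extremal chain has a rung followed by a bridge. The translation by `c = μ / (2 (1 - μ)) ≥ μ / 4`
conjugates one composite into the other, so that an advantage of exactly `c` would be preserved. -/
theorem bridgeMap_rungMap_add_le (h0 : 0 < μ) (h1 : μ ≤ 1 / 9) (hx : 0 < x)
    (hr : 0 < rungMap x - μ / 2) (hb : 0 < bridgeMap μ (rungMap x - μ / 2)) :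
    bridgeMap μ (rungMap x - μ / 2) + μ / 4 ≤ rungMap (bridgeMap μ (x + μ / 4) - μ / 2) := by
  obtain ⟨hn, -⟩ := bridgeMap_sub_pos h0 (by linarith) hx hr hb
  obtain ⟨hd, e⟩ := bridgeMap_rungMap hx hr (by linarith)
  have hc : 0 < (4 - μ) * (1 - μ) := by nlinarith
  have hd0 : 0 < 1 - 4 * μ + μ ^ 2 := by nlinarith
  have hx' : 0 < x + μ / 4 := by linarith
  have hd' : 0 < (4 - μ) * (1 - μ) * (x + μ / 4) + (1 - 4 * μ + μ ^ 2) := by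
    nlinarith [mul_pos hc hx']
  rw [e, rungMap_bridgeMap hx' (by linarith), div_add' _ _ _ hd.ne', div_le_div_iff₀ hd hd']
  have key : (1 - μ) * (((1 - 2 * μ + μ ^ 2 / 2) * (x + μ / 4) - (3 * μ - μ ^ 2) / 2)
        * ((4 - μ) * (1 - μ) * x + (1 - 2 * μ + μ ^ 2 / 2))
      - ((1 - 4 * μ + μ ^ 2) * x - (3 * μ - μ ^ 2) / 2
          + μ / 4 * ((4 - μ) * (1 - μ) * x + (1 - 2 * μ + μ ^ 2 / 2)))
        * ((4 - μ) * (1 - μ) * (x + μ / 4) + (1 - 4 * μ + μ ^ 2)))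
      = μ * (1 + μ) / 4 * (((4 - μ) * (1 - μ) * x + (1 - 2 * μ + μ ^ 2 / 2))
        * ((4 - μ) * (1 - μ) * (x + μ / 4) + (1 - 4 * μ + μ ^ 2)) - 1) := by ring
  have hxlow : (3 * μ - μ ^ 2) / 2 ≤ x := by nlinarith
  have hc3 : 3 ≤ (4 - μ) * (1 - μ) := by nlinarith
  have hcx := mul_le_mul hc3 hxlow (by nlinarith) hc.le
  have hS : 1 ≤ (4 - μ) * (1 - μ) * x + (1 - 2 * μ + μ ^ 2 / 2) := by nlinarith
  have hQ : 1 ≤ (4 - μ) * (1 - μ) * (x + μ / 4) + (1 - 4 * μ + μ ^ 2) := by nlinarith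
  have hSQ := one_le_mul_of_one_le_of_one_le hS hQ
  have h2 : 0 ≤ μ * (1 + μ) / 4 * (((4 - μ) * (1 - μ) * x + (1 - 2 * μ + μ ^ 2 / 2))
        * ((4 - μ) * (1 - μ) * (x + μ / 4) + (1 - 4 * μ + μ ^ 2)) - 1) :=
    mul_nonneg (by positivity) (by linarith)
  rw [← key] at h2
  have := nonneg_of_mul_nonneg_right h2 (by linarith)
  linarith

/-- The same exchange on the first block after `K₄` minus an edge produces an advantage. -/
theorem bridgeMap_rungMap_add_le_of_start (h0 : 0 < μ) (h1 : μ ≤ 1 / 11)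
    (hx : 2 * (4 - μ) * x = 2 - 5 * μ + μ ^ 2) (hr : 0 < rungMap x - μ / 2) :
    bridgeMap μ (rungMap x - μ / 2) + μ / 4 ≤ rungMap (bridgeMap μ x - μ / 2) := by
  have hx0 : 0 < x := by
    have : 0 < 2 * (4 - μ) * x := by rw [hx]; nlinarith
    exact pos_of_mul_pos_right this (by linarith)
  obtain ⟨hd, e⟩ := bridgeMap_rungMap hx0 hr (by linarith)
  have hc : 0 < (4 - μ) * (1 - μ) := by nlinarith
  have hd0 : 0 < 1 - 4 * μ + μ ^ 2 := by nlinarith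
  have hd' : 0 < (4 - μ) * (1 - μ) * x + (1 - 4 * μ + μ ^ 2) := by
    nlinarith [mul_pos hc hx0]
  rw [e, rungMap_bridgeMap hx0 (by linarith), div_add' _ _ _ hd.ne', div_le_div_iff₀ hd hd']
  have e1 : (4 - μ) * (1 - μ) * x = (1 - μ) * ((2 - 5 * μ + μ ^ 2) / 2) := by
    linear_combination (1 - μ) / 2 * hx
  have key : ((1 - 2 * μ + μ ^ 2 / 2) * x - (3 * μ - μ ^ 2) / 2)
        * ((4 - μ) * (1 - μ) * x + (1 - 2 * μ + μ ^ 2 / 2))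
      - ((1 - 4 * μ + μ ^ 2) * x - (3 * μ - μ ^ 2) / 2)
        * ((4 - μ) * (1 - μ) * x + (1 - 4 * μ + μ ^ 2))
      = μ / 2 * ((1 - μ) * ((2 - 5 * μ + μ ^ 2) / 2) ^ 2
        + (2 - 6 * μ + 3 / 2 * μ ^ 2) * ((2 - 5 * μ + μ ^ 2) / 2)
        - (4 - μ) * (3 * μ - μ ^ 2) / 2) := by
    rw [← hx]; ring
  have hpoly : ((1 - μ) * ((2 - 5 * μ + μ ^ 2) / 2) + (1 - 2 * μ + μ ^ 2 / 2))
        * ((1 - μ) * ((2 - 5 * μ + μ ^ 2) / 2) + (1 - 4 * μ + μ ^ 2))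
      ≤ 2 * ((1 - μ) * ((2 - 5 * μ + μ ^ 2) / 2) ^ 2
        + (2 - 6 * μ + 3 / 2 * μ ^ 2) * ((2 - 5 * μ + μ ^ 2) / 2)
        - (4 - μ) * (3 * μ - μ ^ 2) / 2) := by
    rw [← sub_nonneg]
    ring_nf
    nlinarith [pow_pos h0 2, pow_pos h0 3, pow_pos h0 4, pow_pos h0 5, pow_pos h0 6]
  rw [e1] at key ⊢
  have := mul_le_mul_of_nonneg_left hpoly (show 0 ≤ μ / 4 by linarith)
  nlinarith

/-- The inequality needed at the grounded end, with the denominators cleared. -/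
theorem bridgeMap_cross_lt (h0 : 0 < μ) (h1 : μ < 1) (hx : 0 ≤ x)
    (h : μ * (4 - μ) * ((2 - μ) * x + (1 - μ)) < 2 * (3 - μ) * ((1 - μ) * x - μ)) :
    μ / (6 - 2 * μ) < bridgeMap μ x - μ / 2 := by
  rw [lt_sub_iff_add_lt]
  have e : μ / (6 - 2 * μ) + μ / 2 = μ * (4 - μ) / (2 * (3 - μ)) := by
    have : (3 - μ) ≠ 0 := by linarith
    have h6 : (6 - 2 * μ) = 2 * (3 - μ) := by ring
    rw [h6]
    field_simp
    ring
  rw [e, bridgeMap, div_lt_div_iff₀ (by linarith) (bridgeMap_denom_pos h1 hx)]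
  linarith

theorem eq_of_rungMap_eq (h1 : μ < 1) (hx : 0 < x)
    (h : rungMap x - μ / 2 = μ / (1 - μ)) : 2 * (1 - 4 * μ + μ ^ 2) * x = μ * (3 - μ) := by
  unfold rungMap at h
  have h2 : (1 + 2 * x) ≠ 0 := by positivity
  have h3 : 1 - μ ≠ 0 := by linarith
  have e : x * (2 * (1 - μ)) = μ * (3 - μ) * (1 + 2 * x) := by
    have h4 := div_mul_cancel₀ x h2
    have h5 := div_mul_cancel₀ μ h3
    have h6 : x / (1 + 2 * x) = μ / 2 + μ / (1 - μ) := by linarith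
    rw [h6] at h4
    linear_combination (-2) * (1 - μ) * h4 + 2 * (1 + 2 * x) * h5
  linear_combination e

/-- At the grounded end, an advantage of `μ / 4` outweighs what is gained by a last cut of size
at least three. -/
theorem lt_bridgeMap_of_advantage (h0 : 0 < μ) (h1 : μ ≤ 1 / 9) (hx : 0 < x)
    (h : rungMap x - μ / 2 = μ / (1 - μ)) :
    μ / (6 - 2 * μ) < bridgeMap μ (x + μ / 4) - μ / 2 := by
  have e := eq_of_rungMap_eq (by linarith) hx h
  have hd0 : 0 < 1 - 4 * μ + μ ^ 2 := by nlinarith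
  refine bridgeMap_cross_lt h0 (by linarith) (by linarith) ?_
  have hy : 4 * (1 - 4 * μ + μ ^ 2) * (x + μ / 4) = μ * (7 - 6 * μ + μ ^ 2) := by
    linear_combination 2 * e
  have hpoly : (4 - μ) * (μ * (2 - μ) * (7 - 6 * μ + μ ^ 2) + 4 * (1 - 4 * μ + μ ^ 2) * (1 - μ))
      < 2 * (3 - μ) * ((1 - μ) * (7 - 6 * μ + μ ^ 2) - 4 * (1 - 4 * μ + μ ^ 2)) := by
    rw [← sub_pos]
    ring_nf
    nlinarith [pow_pos h0 2, pow_pos h0 3, pow_pos h0 4, pow_pos h0 5, pow_pos h0 6]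
  have h2 := mul_lt_mul_of_pos_left hpoly h0
  refine lt_of_mul_lt_mul_left (a := 4 * (1 - 4 * μ + μ ^ 2)) ?_ (by linarith)
  have e1 : 4 * (1 - 4 * μ + μ ^ 2) * (μ * (4 - μ) * ((2 - μ) * (x + μ / 4) + (1 - μ)))
      = μ * ((4 - μ) * (μ * (2 - μ) * (7 - 6 * μ + μ ^ 2)
        + 4 * (1 - 4 * μ + μ ^ 2) * (1 - μ))) := by
    linear_combination μ * (4 - μ) * (2 - μ) * hy
  have e2 : 4 * (1 - 4 * μ + μ ^ 2) * (2 * (3 - μ) * ((1 - μ) * (x + μ / 4) - μ))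
      = μ * (2 * (3 - μ) * ((1 - μ) * (7 - 6 * μ + μ ^ 2) - 4 * (1 - 4 * μ + μ ^ 2))) := by
    linear_combination 2 * (3 - μ) * (1 - μ) * hy
  rw [e1, e2]
  exact h2

/-- The case of seven vertices, where the eigenvalue is determined by `hx` and `h`. -/
theorem lt_bridgeMap_of_start (h0 : 0 < μ) (h1 : μ ≤ 1 / 7)
    (hx : 2 * (4 - μ) * x = 2 - 5 * μ + μ ^ 2) (h : rungMap x - μ / 2 = μ / (1 - μ)) :
    μ / (6 - 2 * μ) < bridgeMap μ x - μ / 2 := by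
  have hx0 : 0 < x := by
    have : 0 < 2 * (4 - μ) * x := by rw [hx]; nlinarith
    exact pos_of_mul_pos_right this (by linarith)
  have e := eq_of_rungMap_eq (by linarith) hx0 h
  have hd0 : 0 < 1 - 4 * μ + μ ^ 2 := by nlinarith
  have hlow : 3 / 50 ≤ μ := by
    by_contra hcon
    push Not at hcon
    have e3 : (2 - 5 * μ + μ ^ 2) * (1 - 4 * μ + μ ^ 2) = (4 - μ) * (μ * (3 - μ)) := by
      rw [← hx, ← e]; ring
    nlinarith [pow_pos h0 2, pow_pos h0 3]
  refine bridgeMap_cross_lt h0 (by linarith) hx0.le ?_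
  have hpoly : (4 - μ) * (μ * (2 - μ) * (3 - μ) + 2 * (1 - 4 * μ + μ ^ 2) * (1 - μ))
      < 2 * (3 - μ) * ((1 - μ) * (3 - μ) - 2 * (1 - 4 * μ + μ ^ 2)) := by
    rw [← sub_pos]
    ring_nf
    nlinarith [pow_pos h0 2, pow_pos h0 3, pow_pos h0 4, pow_pos h0 5, pow_pos h0 6]
  have h2 := mul_lt_mul_of_pos_left hpoly h0
  refine lt_of_mul_lt_mul_left (a := 2 * (1 - 4 * μ + μ ^ 2)) ?_ (by linarith)
  have e1 : 2 * (1 - 4 * μ + μ ^ 2) * (μ * (4 - μ) * ((2 - μ) * x + (1 - μ)))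
      = μ * ((4 - μ) * (μ * (2 - μ) * (3 - μ) + 2 * (1 - 4 * μ + μ ^ 2) * (1 - μ))) := by
    linear_combination μ * (4 - μ) * (2 - μ) * e
  have e2 : 2 * (1 - 4 * μ + μ ^ 2) * (2 * (3 - μ) * ((1 - μ) * x - μ))
      = μ * (2 * (3 - μ) * ((1 - μ) * (3 - μ) - 2 * (1 - 4 * μ + μ ^ 2))) := by
    linear_combination 2 * (3 - μ) * (1 - μ) * e
  rw [e1, e2]
  exact h2

end

/-! ### The ratios along a sorted graph -/

/-- The value of `f` with which the pair of vertices `p, p + 1` is entered from the left: the value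
at `p` if the cut between the two vertices is a bridge, and their mean value otherwise. -/
noncomputable def entry (A : ℕ → ℕ → ℤ) (f : ℕ → ℝ) (p : ℕ) : ℝ :=
  if cut A (p + 1) = 1 then f p else (f p + f (p + 1)) / 2

/-- The value of `f` with which the pair of vertices `p, p + 1` is left to the right. -/
noncomputable def exit (A : ℕ → ℕ → ℤ) (f : ℕ → ℝ) (p : ℕ) : ℝ :=
  if cut A (p + 1) = 1 then f (p + 1) else (f p + f (p + 1)) / 2

/-- The ratio in front of the pair `p, p + 1`. -/
noncomputable def entryRatio (A : ℕ → ℕ → ℤ) (f : ℕ → ℝ) (p : ℕ) : ℝ :=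
  entry A f p / partialSum f p

/-- The ratio behind the pair `p, p + 1`. -/
noncomputable def exitRatio (A : ℕ → ℕ → ℤ) (f : ℕ → ℝ) (p : ℕ) : ℝ :=
  exit A f p / partialSum f (p + 2)

namespace IsSortedSubsolution

variable {n : ℕ} {A : ℕ → ℕ → ℤ} {μ : ℝ} {f : ℕ → ℝ} (hf : IsSortedSubsolution n A μ f)
  (hA : IsSubcubicNetwork n A)
include hf hA

/-- The drop across a cut of even index, with half of the drops inside the adjacent unbridged pairs
added to it: each such pair is crossed by at least half of the edges of the cut. -/
theorem exit_sub_entry_le {k : ℕ} (hk : k % 2 = 0) (hkn : k + 2 ≤ n) :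
    exit A f k - entry A f (k + 2) ≤ μ / 2 * partialSum f (k + 2) ∧
    (cut A (k + 2) = 2 ∨
      exit A f k - entry A f (k + 2) ≤ μ / 4 * partialSum f (k + 2)) := by
  have hflux := hf.flux_ge hA hkn
  have d0 : 0 ≤ f k - f (k + 1) := sub_nonneg.2 (hf.antitone (by omega))
  have d1 : 0 ≤ f (k + 1) - f (k + 2) := sub_nonneg.2 (hf.antitone (by omega))
  have d2 : 0 ≤ f (k + 2) - f (k + 3) := sub_nonneg.2 (hf.antitone (by omega))
  have hc2 := hA.two_le_cut_of_even (p := k + 2) (by omega) hkn (by omega)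
  have hc1 := hA.cut_eq_one_or_three_le (p := k + 1) (by omega) (by omega)
  have hc3 : cut A (k + 3) = 1 ∨ 3 ≤ cut A (k + 3) := by
    rcases hkn.lt_or_eq with h | h
    · exact hA.cut_eq_one_or_three_le (by omega) (by omega)
    · exact Or.inr (hA.three_le_cut_succ_of_le h (by omega))
  have hpar := hA.cut_parity (k + 2)
  have s1 := hA.cut_succ (k + 1)
  have s2 := hA.cut_succ (k + 2)
  rw [show k + 1 + 1 = k + 2 from rfl] at s1
  rw [show k + 2 + 1 = k + 3 from rfl] at s2
  set X := cut A (k + 1) - nbrsBelow A (k + 1) (k + 1) with hX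
  set Y := cut A (k + 2) - nbrsBelow A (k + 2) (k + 2) with hY
  have eX : exit A f k = f (k + 1) + (if cut A (k + 1) = 1 then 0 else (f k - f (k + 1)) / 2) := by
    unfold exit; split_ifs <;> ring
  have eY : entry A f (k + 2)
      = f (k + 2) - (if cut A (k + 3) = 1 then 0 else (f (k + 2) - f (k + 3)) / 2) := by
    unfold entry; split_ifs <;> ring
  have key : ∀ m : ℤ, 1 ≤ m → 2 * m ≤ cut A (k + 2) → m ≤ 2 →
      2 * m * (exit A f k - entry A f (k + 2)) ≤ μ * partialSum f (k + 2) := by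
    intro m hm hm2 hm3
    have hXm : (if cut A (k + 1) = 1 then 0 else m) ≤ X := by split_ifs with h <;> omega
    have hYm : (if cut A (k + 3) = 1 then 0 else m) ≤ Y := by split_ifs with h <;> omega
    have hXr : (if cut A (k + 1) = 1 then (0 : ℝ) else m) ≤ X := by exact_mod_cast hXm
    have hYr : (if cut A (k + 3) = 1 then (0 : ℝ) else m) ≤ Y := by exact_mod_cast hYm
    have hcr : (2 * m : ℝ) ≤ cut A (k + 2) := by exact_mod_cast hm2
    have t1 := mul_le_mul_of_nonneg_right hcr d1
    have t2 := mul_le_mul_of_nonneg_right hXr d0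
    have t3 := mul_le_mul_of_nonneg_right hYr d2
    have hXc : (X : ℝ) = cut A (k + 1) - nbrsBelow A (k + 1) (k + 1) := by rw [hX]; push_cast; rfl
    have hYc : (Y : ℝ) = cut A (k + 2) - nbrsBelow A (k + 2) (k + 2) := by rw [hY]; push_cast; rfl
    rw [← hXc, ← hYc] at hflux
    rw [eX, eY]
    split_ifs at t2 t3 ⊢ <;> linarith
  refine ⟨?_, ?_⟩
  · have := key 1 le_rfl (by omega) (by omega)
    push_cast at this
    linarith
  · by_cases h : cut A (k + 2) = 2
    · exact Or.inl h
    · have := key 2 (by omega) (by omega) le_rfl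
      push_cast at this
      exact Or.inr (by linarith)

theorem exitRatio_sub_le {k : ℕ} (hk : k % 2 = 0) (hkn : k + 2 ≤ n) :
    exitRatio A f k - μ / 2 ≤ entryRatio A f (k + 2) ∧
    (cut A (k + 2) = 2 ∨ exitRatio A f k - μ / 4 ≤ entryRatio A f (k + 2)) := by
  have hF := hf.partialSum_pos (p := k + 2) (by omega) (by omega)
  obtain ⟨h1, h2⟩ := hf.exit_sub_entry_le hA hk hkn
  unfold exitRatio entryRatio
  refine ⟨?_, h2.imp_right fun h2 => ?_⟩
  · rw [sub_le_iff_le_add, div_le_iff₀ hF, add_mul, div_mul_cancel₀ _ hF.ne']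
    linarith
  · rw [sub_le_iff_le_add, div_le_iff₀ hF, add_mul, div_mul_cancel₀ _ hF.ne']
    linarith

omit hA in
theorem entryRatio_pos {p : ℕ} (hp : 1 ≤ p) (hpn : p < n) : 0 < entryRatio A f p := by
  have h0 := hf.pos p hpn
  have h1 := hf.nonneg (p + 1)
  refine div_pos ?_ (hf.partialSum_pos hp (by omega))
  unfold entry
  split_ifs <;> linarith

omit hA in
theorem exitRatio_of_cut_ne_one {p : ℕ} (hp : 1 ≤ p) (hn : 1 ≤ n) (h : cut A (p + 1) ≠ 1) :
    exitRatio A f p = rungMap (entryRatio A f p) := by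
  have hF := hf.partialSum_pos hp hn
  unfold exitRatio entryRatio exit entry rungMap
  rw [partialSum_succ, partialSum_succ]
  simp only [h, if_false]
  have h0 := hf.nonneg p
  have h1 := hf.nonneg (p + 1)
  rw [show partialSum f p + f p + f (p + 1)
    = partialSum f p * (1 + 2 * ((f p + f (p + 1)) / 2 / partialSum f p)) by field_simp; ring]
  rw [div_mul_eq_div_div]

theorem bridgeMap_le_exitRatio {p : ℕ} (hp : 1 ≤ p) (hpn : p + 1 ≤ n) (hpe : p % 2 = 0)
    (hμ : μ < 1) (h : cut A (p + 1) = 1) :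
    bridgeMap μ (entryRatio A f p) ≤ exitRatio A f p := by
  have hF := hf.partialSum_pos hp (by omega : 1 ≤ n)
  have hx := hf.entryRatio_pos hp (by omega : p < n) (A := A)
  obtain ⟨k, rfl⟩ : ∃ k, p = k + 1 := ⟨p - 1, by omega⟩
  have hflux := hf.flux_ge hA hpn
  have d0 : 0 ≤ f k - f (k + 1) := sub_nonneg.2 (hf.antitone (by omega))
  have d2 : 0 ≤ f (k + 2) - f (k + 3) := sub_nonneg.2 (hf.antitone (by omega))
  have hc := hA.two_le_cut_of_even hp (by omega) hpe
  have s1 := hA.cut_succ (k + 1)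
  rw [show k + 1 + 1 = k + 2 from rfl] at s1 h
  have hX : (0 : ℤ) ≤ cut A (k + 1) - nbrsBelow A (k + 1) (k + 1) := by omega
  have hY : (0 : ℤ) ≤ cut A (k + 2) - nbrsBelow A (k + 2) (k + 2) := by
    have := hA.nbrsBelow_add_le_cut (k + 2)
    have := hA.nbrsBelow_nonneg (k + 2) (k + 2 + 1)
    omega
  have hXr : (0 : ℝ) ≤ cut A (k + 1) - nbrsBelow A (k + 1) (k + 1) := by exact_mod_cast hX
  have hYr : (0 : ℝ) ≤ cut A (k + 2) - nbrsBelow A (k + 2) (k + 2) := by exact_mod_cast hY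
  have hdrop : f (k + 1) - f (k + 2) ≤ μ * (partialSum f (k + 1) + f (k + 1)) := by
    rw [← partialSum_succ]
    have t0 := mul_nonneg hXr d0
    have t2 := mul_nonneg hYr d2
    have hcr : (cut A (k + 2) : ℝ) = 1 := by exact_mod_cast h
    rw [hcr] at hflux t2
    linarith
  have hfk := hf.nonneg (k + 2)
  have hfk1 := hf.nonneg (k + 1)
  have hden := bridgeMap_denom_pos hμ hx.le
  unfold bridgeMap exitRatio
  rw [show k + 1 + 2 = k + 1 + 1 + 1 from rfl, partialSum_succ, partialSum_succ]
  unfold entryRatio exit entry at *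
  rw [show k + 1 + 1 = k + 2 from rfl]
  simp only [show k + 1 + 1 = k + 2 from rfl, h, if_true] at hden hx ⊢
  rw [div_le_div_iff₀ hden (by linarith)]
  set F := partialSum f (k + 1)
  have e : f (k + 1) = f (k + 1) / F * F := (div_mul_cancel₀ _ hF.ne').symm
  set x := f (k + 1) / F
  rw [e] at hdrop ⊢
  have h1 : 0 ≤ F * (1 + x) := by positivity
  nlinarith [mul_nonneg (show 0 ≤ f (k + 2) - (x * F - μ * (F + x * F)) by linarith)
    (show 0 ≤ 1 + x by positivity)]

end IsSortedSubsolution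

/-! ### Single steps along a sorted graph -/

/-- The ratio behind the first four vertices of the extremal chain. -/
noncomputable def startRatio (μ : ℝ) : ℝ := rungMap (1 / 2 - μ / 4)

theorem startRatio_sub {μ : ℝ} (h1 : μ < 1) :
    2 * (4 - μ) * (startRatio μ - μ / 2) = 2 - 5 * μ + μ ^ 2 := by
  unfold startRatio rungMap
  have h : 1 + 2 * (1 / 2 - μ / 4) ≠ 0 := by linarith
  have h2 := div_mul_cancel₀ (1 / 2 - μ / 4) h
  linear_combination 4 * h2

/-- The cuts with index from `4` to `k` that determine the graph agree with those of the extremal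
chain: those of even index have size two, and those of index congruent to `r` modulo `4` are
bridges. -/
def HasChainCuts (A : ℕ → ℕ → ℤ) (r k : ℕ) : Prop :=
  ∀ p, 4 ≤ p → p ≤ k → (p % 2 = 0 → cut A p = 2) ∧ (p % 4 = r → cut A p = 1)

namespace IsSortedSubsolution

variable {n : ℕ} {A : ℕ → ℕ → ℤ} {μ : ℝ} {f : ℕ → ℝ} (hf : IsSortedSubsolution n A μ f)
  (hA : IsSubcubicNetwork n A)
include hf hA

theorem startRatio_le (hn : 4 ≤ n) (h0 : 0 < μ) (h1 : μ < 1) :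
    startRatio μ ≤ exitRatio A f 2 := by
  have e0 : exitRatio A f 0 = 1 / 2 := by
    have hF := hf.partialSum_pos (p := 2) (by omega) (by omega)
    have : partialSum f 2 = f 0 + f 1 := by simp [partialSum, Finset.sum_range_succ]
    unfold exitRatio exit
    rw [show (0 : ℕ) + 2 = 2 from rfl, show (0 : ℕ) + 1 = 1 from rfl, hA.cut_one, this]
    rw [this] at hF
    norm_num
    field_simp
  obtain ⟨-, h2⟩ := hf.exitRatio_sub_le hA (k := 0) rfl (by omega)
  have hc2 := hA.four_le_cut_two
  have hc3 := hA.three_le_cut_three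
  rw [show (0 : ℕ) + 2 = 2 from rfl, e0] at h2
  have h3 := h2.resolve_left (by omega)
  rw [hf.exitRatio_of_cut_ne_one (p := 2) (by omega) (by omega)
    (by rw [show 2 + 1 = 3 from rfl]; omega)]
  exact rungMap_le_rungMap (by linarith) h3

/-- If the ratio in front of a pair is minimal, then so is the ratio behind the preceding pair, and
the cut between them has size two. -/
theorem cut_eq_two_of_entryRatio_le {k : ℕ} {t : ℝ} (h0 : 0 < μ) (hk : k % 2 = 0)
    (hkn : k + 2 ≤ n) (ht : t ≤ exitRatio A f k) (h : entryRatio A f (k + 2) ≤ t - μ / 2) :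
    exitRatio A f k ≤ t ∧ cut A (k + 2) = 2 := by
  obtain ⟨h1, h2⟩ := hf.exitRatio_sub_le hA hk hkn
  refine ⟨by linarith, h2.resolve_right fun h3 => ?_⟩
  linarith

/-- Over one pair of vertices the ratio cannot drop by more than it does when the pair is bridged,
and it stays above that bound by `μ / 4` when the pair is not bridged. -/
theorem bridge_step {k : ℕ} {t : ℝ} (h0 : 0 < μ) (h1 : μ < 1) (hk : k % 2 = 0)
    (hkn : k + 4 ≤ n) (hx : 0 < t - μ / 2) (ht : t ≤ exitRatio A f k) :
    bridgeMap μ (t - μ / 2) ≤ exitRatio A f (k + 2) ∧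
    (exitRatio A f (k + 2) ≤ bridgeMap μ (t - μ / 2) →
      exitRatio A f k ≤ t ∧ cut A (k + 2) = 2 ∧ cut A (k + 3) = 1) ∧
    (cut A (k + 3) ≠ 1 → bridgeMap μ (t - μ / 2) + μ / 4 ≤ exitRatio A f (k + 2)) := by
  obtain ⟨h2, -⟩ := hf.exitRatio_sub_le hA hk (by omega)
  have hle : t - μ / 2 ≤ entryRatio A f (k + 2) := by linarith
  by_cases hc : cut A (k + 3) = 1
  · have h3 := hf.bridgeMap_le_exitRatio hA (p := k + 2) (by omega) (by omega) (by omega) h1 hc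
    refine ⟨(bridgeMap_le_bridgeMap h1 hx.le hle).trans h3, fun h4 => ?_, fun h => absurd hc h⟩
    have h5 := le_of_bridgeMap_le h1 (hx.le.trans hle) hx.le (h3.trans h4)
    obtain ⟨h6, h7⟩ := hf.cut_eq_two_of_entryRatio_le hA h0 hk (by omega) ht h5
    exact ⟨h6, h7, hc⟩
  · have h3 := hf.exitRatio_of_cut_ne_one (p := k + 2) (by omega) (by omega) hc
    have h4 := rungMap_le_rungMap hx.le hle
    rw [← h3] at h4
    have h5 := bridgeMap_add_le_rungMap h0 h1 hx.le
    exact ⟨by linarith, fun h => by linarith, fun _ => by linarith⟩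

/-- Over two consecutive pairs of vertices, the ratio cannot drop by more than it does when the
first pair is unbridged and the second one bridged. -/
theorem block_step {k : ℕ} {t : ℝ} (h0 : 0 < μ) (h1 : μ ≤ 1 / 2) (hk : k % 2 = 0)
    (hkn : k + 6 ≤ n) (hx : 0 < t - μ / 2) (hr : 0 < rungMap (t - μ / 2) - μ / 2)
    (hb : 0 < bridgeMap μ (rungMap (t - μ / 2) - μ / 2)) (ht : t ≤ exitRatio A f k) :
    bridgeMap μ (rungMap (t - μ / 2) - μ / 2) ≤ exitRatio A f (k + 4) ∧
    (exitRatio A f (k + 4) ≤ bridgeMap μ (rungMap (t - μ / 2) - μ / 2) →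
      exitRatio A f k ≤ t ∧ cut A (k + 2) = 2 ∧ cut A (k + 4) = 2 ∧ cut A (k + 5) = 1) := by
  have h1' : μ < 1 := by linarith
  obtain ⟨h2, -⟩ := hf.exitRatio_sub_le hA hk (by omega)
  have hle : t - μ / 2 ≤ entryRatio A f (k + 2) := by linarith
  by_cases hc : cut A (k + 3) = 1
  · -- A bridge in the first pair excludes a bridge in the second one.
    have h3 := hf.bridgeMap_le_exitRatio hA (p := k + 2) (by omega) (by omega) (by omega) h1' hc
    have h4 := (bridgeMap_le_bridgeMap h1' hx.le hle).trans h3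
    have hc' := hA.three_le_cut_of_cut_eq_one hc
    obtain ⟨h5, -⟩ := hf.exitRatio_sub_le hA (k := k + 2) (by omega) (by omega)
    have h6 := hf.exitRatio_of_cut_ne_one (p := k + 4) (by omega) (by omega)
      (by rw [show k + 4 + 1 = k + 3 + 2 from rfl]; omega)
    obtain ⟨-, h7⟩ := bridgeMap_sub_pos h0 h1' hx hr hb
    have h8 : bridgeMap μ (t - μ / 2) - μ / 2 ≤ entryRatio A f (k + 4) := by
      have h9 : exitRatio A f (k + 2) - μ / 2 ≤ entryRatio A f (k + 4) := h5
      linarith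
    have h9 := rungMap_le_rungMap h7.le h8
    have h10 := bridgeMap_rungMap_lt h0 h1 hx hr hb
    rw [← h6] at h9
    exact ⟨by linarith, fun h => by linarith⟩
  · have h3 := hf.exitRatio_of_cut_ne_one (p := k + 2) (by omega) (by omega) hc
    have h4 := rungMap_le_rungMap hx.le hle
    rw [← h3] at h4
    obtain ⟨h5, h6, -⟩ := hf.bridge_step hA (k := k + 2) h0 h1' (by omega) (by omega) hr h4
    refine ⟨h5, fun h => ?_⟩
    obtain ⟨h7, h8, h9⟩ := h6 h
    rw [h3] at h7
    have h10 := le_of_rungMap_le (hx.le.trans hle) hx.le h7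
    obtain ⟨h11, h12⟩ := hf.cut_eq_two_of_entryRatio_le hA h0 hk (by omega) ht h10
    exact ⟨h11, h12, h8, h9⟩

/-- A graph whose bridges are out of phase with those of the extremal chain is ahead of the latter
by at least `μ / 4`. -/
theorem block_step_advantage {k : ℕ} {t : ℝ} (h0 : 0 < μ) (h1 : μ ≤ 1 / 9) (hk : k % 2 = 0)
    (hkn : k + 6 ≤ n) (hx : 0 < t - μ / 2) (hr : 0 < rungMap (t - μ / 2) - μ / 2)
    (hb : 0 < bridgeMap μ (rungMap (t - μ / 2) - μ / 2)) (ht : t ≤ exitRatio A f k)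
    (hadv : cut A (k + 3) = 1 → t + μ / 4 ≤ exitRatio A f k ∨ (t = startRatio μ ∧ μ ≤ 1 / 11))
    (hc5 : cut A (k + 5) ≠ 1) :
    bridgeMap μ (rungMap (t - μ / 2) - μ / 2) + μ / 4 ≤ exitRatio A f (k + 4) := by
  have h1' : μ < 1 := by linarith
  obtain ⟨h2, -⟩ := hf.exitRatio_sub_le hA hk (by omega)
  by_cases hc : cut A (k + 3) = 1
  · have h3 := hf.bridgeMap_le_exitRatio hA (p := k + 2) (by omega) (by omega) (by omega) h1' hc
    obtain ⟨h5, -⟩ := hf.exitRatio_sub_le hA (k := k + 2) (by omega) (by omega)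
    have h6 := hf.exitRatio_of_cut_ne_one (p := k + 4) (by omega) (by omega) hc5
    obtain ⟨-, h7⟩ := bridgeMap_sub_pos h0 h1' hx hr hb
    rw [h6]
    have h8 : exitRatio A f (k + 2) - μ / 2 ≤ entryRatio A f (k + 4) := h5
    rcases hadv hc with h9 | ⟨h9, h10⟩
    · have h10 : bridgeMap μ (t - μ / 2 + μ / 4) ≤ exitRatio A f (k + 2) :=
        (bridgeMap_le_bridgeMap h1' (by linarith) (by linarith)).trans h3
      have h11 := bridgeMap_le_bridgeMap h1' hx.le (show t - μ / 2 ≤ t - μ / 2 + μ / 4 by linarith)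
      exact (bridgeMap_rungMap_add_le h0 h1 hx hr hb).trans
        (rungMap_le_rungMap (by linarith) (by linarith))
    · have h11 := (bridgeMap_le_bridgeMap h1' hx.le (by linarith)).trans h3
      refine (bridgeMap_rungMap_add_le_of_start h0 h10 ?_ hr).trans
        (rungMap_le_rungMap h7.le (by linarith))
      rw [h9]
      exact startRatio_sub h1'
  · have h3 := hf.exitRatio_of_cut_ne_one (p := k + 2) (by omega) (by omega) hc
    have h4 := rungMap_le_rungMap hx.le (show t - μ / 2 ≤ entryRatio A f (k + 2) by linarith)
    rw [← h3] at h4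
    exact (hf.bridge_step hA (k := k + 2) h0 h1' (by omega) (by omega) hr h4).2.2 hc5

/-- The grounded end for an even number of vertices. -/
theorem even_end {k : ℕ} (h0 : 0 < μ) (hk : k % 2 = 0) (hkn : k + 2 = n)
    (ht : μ / 2 ≤ exitRatio A f k) : exitRatio A f k ≤ μ / 2 ∧ cut A (k + 2) = 2 := by
  refine hf.cut_eq_two_of_entryRatio_le hA h0 hk hkn.le ht ?_
  have e : entryRatio A f (k + 2) = 0 := by
    unfold entryRatio entry
    rw [hf.zero (k + 2) hkn.ge, hf.zero (k + 2 + 1) (by omega)]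
    simp
  rw [e, sub_self]

theorem entryRatio_last_le {k : ℕ} (hk : k % 2 = 0) (hkn : k + 3 = n) (h0 : 0 < μ) (h1 : μ < 1) :
    (cut A (k + 3) = 1 → entryRatio A f (k + 2) ≤ μ / (1 - μ)) ∧
    (cut A (k + 3) ≠ 1 → entryRatio A f (k + 2) ≤ μ / (6 - 2 * μ)) := by
  have hF := hf.partialSum_pos (p := k + 2) (by omega) (by omega)
  have hflux := hf.flux_ge hA (k := k + 1) (by omega)
  have hz := hf.zero (k + 3) hkn.ge
  have hz' := hf.zero (k + 4) (by omega)
  have hpos := hf.nonneg (k + 2)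
  have d0 : 0 ≤ f (k + 1) - f (k + 2) := sub_nonneg.2 (hf.antitone (by omega))
  have s1 := hA.cut_succ (k + 2)
  have hc2 := hA.two_le_cut_of_even (p := k + 2) (by omega) (by omega) (by omega)
  have hc3 := hA.cut_eq_one_or_three_le (p := k + 3) (by omega) (by omega)
  rw [show k + 2 + 1 = k + 3 from rfl] at s1
  have hX : (0 : ℤ) ≤ cut A (k + 2) - nbrsBelow A (k + 2) (k + 2) := by omega
  have hXr : (0 : ℝ) ≤ cut A (k + 2) - nbrsBelow A (k + 2) (k + 2) := by exact_mod_cast hX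
  have t0 := mul_nonneg hXr d0
  rw [show k + 1 + 2 = k + 3 from rfl, show k + 1 + 1 = k + 2 from rfl,
    show k + 1 + 3 = k + 4 from rfl, hz, hz', show k + 3 = k + 2 + 1 from rfl, partialSum_succ,
    show k + 2 + 1 = k + 3 from rfl] at hflux
  have hmain : (cut A (k + 3) : ℝ) * f (k + 2) ≤ μ * (partialSum f (k + 2) + f (k + 2)) := by
    linarith
  unfold entryRatio entry
  rw [show k + 2 + 1 = k + 3 from rfl, hz]
  refine ⟨fun h => ?_, fun h => ?_⟩
  · rw [h] at hmain
    simp only [h, if_true]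
    rw [div_le_div_iff₀ hF (by linarith)]
    push_cast at hmain
    linarith
  · have h3 : (3 : ℝ) ≤ cut A (k + 3) := by exact_mod_cast hc3.resolve_left h
    have := mul_le_mul_of_nonneg_right h3 hpos
    simp only [h, if_false]
    rw [div_le_div_iff₀ hF (by linarith)]
    linarith

/-- The grounded end when the last vertex follows an unbridged pair, or the initial segment. -/
theorem odd_end_last {k : ℕ} {t : ℝ} (h0 : 0 < μ) (h1 : μ < 1) (hk : k % 2 = 0) (hkn : k + 3 = n)
    (hz : t - μ / 2 = μ / (1 - μ)) (ht : t ≤ exitRatio A f k) :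
    exitRatio A f k ≤ t ∧ cut A (k + 2) = 2 ∧ cut A (k + 3) = 1 := by
  obtain ⟨e1, e3⟩ := hf.entryRatio_last_le hA hk hkn h0 h1
  obtain ⟨h2, -⟩ := hf.exitRatio_sub_le hA hk (by omega)
  by_cases hc : cut A (k + 3) = 1
  · obtain ⟨h3, h4⟩ := hf.cut_eq_two_of_entryRatio_le hA h0 hk (by omega) ht (hz ▸ e1 hc)
    exact ⟨h3, h4, hc⟩
  · have h3 := e3 hc
    have h4 : μ / (6 - 2 * μ) < μ / (1 - μ) :=
      div_lt_div_of_pos_left h0 (by linarith) (by linarith)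
    linarith

/-- The grounded end for an odd number of vertices. -/
theorem odd_end {k : ℕ} {t : ℝ} (h0 : 0 < μ) (h1 : μ < 1) (hk : k % 2 = 0) (hkn : k + 5 = n)
    (hx : 0 < t - μ / 2) (hz : rungMap (t - μ / 2) - μ / 2 = μ / (1 - μ))
    (ht : t ≤ exitRatio A f k)
    (hadv : cut A (k + 3) = 1 → μ / (6 - 2 * μ) < bridgeMap μ (exitRatio A f k - μ / 2) - μ / 2) :
    exitRatio A f k ≤ t ∧ cut A (k + 2) = 2 ∧ cut A (k + 4) = 2 ∧ cut A (k + 5) = 1 := by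
  obtain ⟨h2, -⟩ := hf.exitRatio_sub_le hA hk (by omega)
  have hle : t - μ / 2 ≤ entryRatio A f (k + 2) := by linarith
  by_cases hc : cut A (k + 3) = 1
  · exfalso
    have h3 := hf.bridgeMap_le_exitRatio hA (p := k + 2) (by omega) (by omega) (by omega) h1 hc
    have h4 := bridgeMap_le_bridgeMap h1 (hx.le.trans (by linarith)) h2
    obtain ⟨h5, -⟩ := hf.exitRatio_sub_le hA (k := k + 2) (by omega) (by omega)
    have h6 := (hf.entryRatio_last_le hA (k := k + 2) (by omega) (by omega) h0 h1).2
      (by have := hA.three_le_cut_of_cut_eq_one hc; rw [show k + 2 + 3 = k + 3 + 2 from rfl]; omega)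
    have := hadv hc
    linarith
  · have h3 := hf.exitRatio_of_cut_ne_one (p := k + 2) (by omega) (by omega) hc
    have h4 := rungMap_le_rungMap hx.le hle
    rw [← h3] at h4
    obtain ⟨h7, h8, h9⟩ := hf.odd_end_last hA (k := k + 2) h0 h1 (by omega) (by omega) hz h4
    rw [h3] at h7
    have h10 := le_of_rungMap_le (hx.le.trans hle) hx.le h7
    obtain ⟨h11, h12⟩ := hf.cut_eq_two_of_entryRatio_le hA h0 hk (by omega) ht h10
    exact ⟨h11, h12, h8, h9⟩

end IsSortedSubsolution

/-! ### Comparison with the extremal chain -/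

/-- The ratios `T p = h (p - 1) / (h 0 + ⋯ + h (p - 1))` of the Perron vector `h` of the extremal
chain on `n` vertices, whose bridges are the cuts of index congruent to `r` modulo `4`. They are
obtained by alternating the two Möbius maps, each preceded by a shift by `-μ / 2`. -/
structure IsChainRatio (n r : ℕ) (μ : ℝ) (T : ℕ → ℝ) : Prop where
  start : T 4 = startRatio μ
  bridge : r = 1 → 6 ≤ n → 0 < T 4 - μ / 2 ∧ T 6 = bridgeMap μ (T 4 - μ / 2)
  block : ∀ p, 4 ≤ p → p % 4 = (r + 1) % 4 → p + 4 ≤ n →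
    0 < T p - μ / 2 ∧ 0 < rungMap (T p - μ / 2) - μ / 2 ∧
      T (p + 4) = bridgeMap μ (rungMap (T p - μ / 2) - μ / 2) ∧ 0 < T (p + 4)
  even_end : n % 2 = 0 → T n = μ / 2
  odd_end : ∀ p, 4 ≤ p → p % 4 = (r + 1) % 4 → p + 3 = n →
    0 < T p - μ / 2 ∧ rungMap (T p - μ / 2) - μ / 2 = μ / (1 - μ)
  five_end : n = 5 → T 4 - μ / 2 = μ / (1 - μ)

theorem HasChainCuts.extend {A : ℕ → ℕ → ℤ} {r k l : ℕ} (h : HasChainCuts A r k)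
    (h' : ∀ p, k < p → p ≤ l → (p % 2 = 0 → cut A p = 2) ∧ (p % 4 = r → cut A p = 1)) :
    HasChainCuts A r l := by
  intro p hp hpl
  rcases le_or_gt p k with hpk | hpk
  · exact h p hp hpk
  · exact h' p hpk hpl

theorem HasChainCuts.extend_block {A : ℕ → ℕ → ℤ} {r k : ℕ} (h : HasChainCuts A r (k + 1))
    (hk : k % 2 = 0) (hr : r = (k + 1) % 4) (h2 : cut A (k + 2) = 2) (h4 : cut A (k + 4) = 2)
    (h5 : cut A (k + 5) = 1) : HasChainCuts A r (k + 5) := by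
  refine h.extend fun p hp hpk => ?_
  obtain rfl | rfl | rfl | rfl : p = k + 2 ∨ p = k + 3 ∨ p = k + 4 ∨ p = k + 5 := by omega
  · exact ⟨fun _ => h2, fun h => by omega⟩
  · exact ⟨fun h => by omega, fun h => by omega⟩
  · exact ⟨fun _ => h4, fun h => by omega⟩
  · exact ⟨fun h => by omega, fun _ => h5⟩

namespace IsSortedSubsolution

variable {n r : ℕ} {A : ℕ → ℕ → ℤ} {μ : ℝ} {f T : ℕ → ℝ} (hf : IsSortedSubsolution n A μ f)
  (hA : IsSubcubicNetwork n A) (hT : IsChainRatio n r μ T)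
include hf hA hT

/-- After each block the ratio of the sorted graph is at least that of the extremal chain, and
equality forces the cuts so far to be those of the chain. -/
theorem chainRatio_le {k : ℕ} (h0 : 0 < μ) (h1 : μ ≤ 1 / 2) (hk : 2 ≤ k) (hk2 : k % 2 = 0)
    (hr : r = (k + 1) % 4) (hstart : T (k + 2) ≤ exitRatio A f k)
    (hcuts : exitRatio A f k ≤ T (k + 2) → HasChainCuts A r (k + 1)) (m : ℕ)
    (hm : k + 4 * m + 2 ≤ n) :
    T (k + 4 * m + 2) ≤ exitRatio A f (k + 4 * m) ∧
      (exitRatio A f (k + 4 * m) ≤ T (k + 4 * m + 2) → HasChainCuts A r (k + 4 * m + 1)) := by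
  induction m with
  | zero => exact ⟨hstart, hcuts⟩
  | succ m ih =>
    obtain ⟨ih1, ih2⟩ := ih (by omega)
    obtain ⟨b1, b2, b3, b4⟩ := hT.block (k + 4 * m + 2) (by omega) (by omega) (by omega)
    rw [b3] at b4
    obtain ⟨s1, s2⟩ := hf.block_step hA h0 h1 (k := k + 4 * m) (by omega) (by omega) b1 b2 b4 ih1
    rw [show k + 4 * (m + 1) + 2 = k + 4 * m + 2 + 4 by ring, b3,
      show k + 4 * (m + 1) = k + 4 * m + 4 by ring]
    refine ⟨s1, fun h => ?_⟩
    obtain ⟨e1, e2, e3, e4⟩ := s2 h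
    exact (ih2 e1).extend_block (by omega) (by omega) e2 e3 e4

/-- After each block that does not end with a bridge, the ratio of the sorted graph is ahead of that
of the extremal chain by `μ / 4`. -/
theorem chainRatio_add_le {k : ℕ} (h0 : 0 < μ) (h1 : μ ≤ 1 / 9) (hk : 2 ≤ k) (hk2 : k % 2 = 0)
    (hr : r = (k + 1) % 4) (hle : ∀ m, k + 4 * m + 2 ≤ n →
      T (k + 4 * m + 2) ≤ exitRatio A f (k + 4 * m))
    (hstart : cut A (k + 1) ≠ 1 →
      T (k + 2) + μ / 4 ≤ exitRatio A f k ∨ (T (k + 2) = startRatio μ ∧ μ ≤ 1 / 11)) (m : ℕ)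
    (hm : k + 4 * (m + 1) + 2 ≤ n) (hc : cut A (k + 4 * (m + 1) + 1) ≠ 1) :
    T (k + 4 * (m + 1) + 2) + μ / 4 ≤ exitRatio A f (k + 4 * (m + 1)) := by
  have step : ∀ m, k + 4 * (m + 1) + 2 ≤ n → cut A (k + 4 * (m + 1) + 1) ≠ 1 →
      (cut A (k + 4 * m + 3) = 1 → T (k + 4 * m + 2) + μ / 4 ≤ exitRatio A f (k + 4 * m) ∨
        (T (k + 4 * m + 2) = startRatio μ ∧ μ ≤ 1 / 11)) →
      T (k + 4 * (m + 1) + 2) + μ / 4 ≤ exitRatio A f (k + 4 * (m + 1)) := by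
    intro m hm hc hadv
    obtain ⟨b1, b2, b3, b4⟩ := hT.block (k + 4 * m + 2) (by omega) (by omega) (by omega)
    rw [b3] at b4
    rw [show k + 4 * (m + 1) + 1 = k + 4 * m + 5 by ring] at hc
    rw [show k + 4 * (m + 1) + 2 = k + 4 * m + 2 + 4 by ring, b3,
      show k + 4 * (m + 1) = k + 4 * m + 4 by ring]
    exact hf.block_step_advantage hA h0 h1 (by omega) (by omega) b1 b2 b4
      (hle m (by omega)) hadv hc
  have noBridge : ∀ p, cut A (p + 2) = 1 → cut A p ≠ 1 := fun p h h' => by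
    have := hA.three_le_cut_of_cut_eq_one h'
    omega
  induction m with
  | zero =>
    exact step 0 hm hc fun h => hstart (noBridge _ h)
  | succ m ih =>
    refine step (m + 1) hm hc fun h => Or.inl (ih (by omega) (noBridge _ ?_))
    rw [← h]

/-- The cuts of a sorted graph whose spectral radius is not smaller than that of the extremal chain
are those of the extremal chain. -/
theorem hasChainCuts (hn : 4 ≤ n) (hr : r = if n % 4 = 1 ∨ n % 4 = 2 then 1 else 3) (h0 : 0 < μ)
    (h1 : n * μ ≤ 2) (h2 : n % 2 = 1 → n * μ ≤ 1) : HasChainCuts A r n := by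
  have hμ : μ ≤ 1 / 2 := by
    have : (4 : ℝ) ≤ n := by exact_mod_cast hn
    nlinarith
  have hμ1 : μ < 1 := by linarith
  have bound : ∀ c : ℕ, n % 2 = 1 → c ≤ n → 0 < c → μ ≤ 1 / c := by
    intro c hodd hc hc0
    have h3 : (c : ℝ) ≤ n := by exact_mod_cast hc
    have h4 : (0 : ℝ) < c := by exact_mod_cast hc0
    rw [le_div_iff₀ h4]
    nlinarith [h2 hodd]
  have hs := hf.startRatio_le hA hn h0 hμ1
  rw [← hT.start] at hs
  by_cases h5 : n = 5
  · subst h5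
    obtain rfl : r = 1 := by simpa using hr
    obtain ⟨-, e2, e3⟩ := hf.odd_end_last hA (k := 2) h0 hμ1 rfl rfl (hT.five_end rfl) hs
    intro p hp hp5
    obtain rfl | rfl : p = 4 ∨ p = 5 := by omega
    · exact ⟨fun _ => e2, fun h => by omega⟩
    · exact ⟨fun h => by omega, fun _ => e3⟩
  -- The position `k` at which the periodic part starts.
  obtain ⟨k, hk, hkn, hrk, hbase, hcuts, hadv⟩ : ∃ k, (k = 2 ∨ k = 4) ∧ k + 2 ≤ n ∧
      r = (k + 1) % 4 ∧ T (k + 2) ≤ exitRatio A f k ∧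
      (exitRatio A f k ≤ T (k + 2) → HasChainCuts A r (k + 1)) ∧
      (cut A (k + 1) ≠ 1 → (T (k + 2) + μ / 4 ≤ exitRatio A f k ∧ k = 4) ∨
        (T (k + 2) = startRatio μ ∧ k = 2)) := by
    by_cases hshort : n % 4 = 1 ∨ n % 4 = 2
    · obtain rfl : r = 1 := by rw [hr, if_pos hshort]
      obtain ⟨b1, b2⟩ := hT.bridge rfl (by omega)
      obtain ⟨s1, s2, s3⟩ := hf.bridge_step hA (k := 2) h0 hμ1 rfl (by omega) b1 hs
      refine ⟨4, Or.inr rfl, by omega, rfl, ?_, ?_, ?_⟩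
      · rw [b2]; exact s1
      · intro h
        rw [b2] at h
        obtain ⟨-, e2, e3⟩ := s2 h
        intro p hp hp5
        obtain rfl | rfl : p = 4 ∨ p = 5 := by omega
        · exact ⟨fun _ => e2, fun h => by omega⟩
        · exact ⟨fun h => by omega, fun _ => e3⟩
      · intro h
        rw [b2]
        exact Or.inl ⟨s3 h, rfl⟩
    · obtain rfl : r = 3 := by rw [hr, if_neg hshort]
      exact ⟨2, Or.inl rfl, by omega, rfl, hs, fun _ p hp hp3 => by omega,
        fun _ => Or.inr ⟨hT.start, rfl⟩⟩
  have hmain := hf.chainRatio_le hA hT h0 hμ (k := k) (by omega) (by omega) hrk hbase hcuts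
  rcases Nat.mod_two_eq_zero_or_one n with hpar | hpar
  · obtain ⟨m, hm⟩ : ∃ m, n = k + 4 * m + 2 := ⟨(n - k - 2) / 4, by split_ifs at hr <;> omega⟩
    obtain ⟨e1, e2⟩ := hmain m hm.ge
    have hTn := hT.even_end hpar
    rw [← hm, hTn] at e1 e2
    obtain ⟨e3, e4⟩ := hf.even_end hA h0 (by omega) hm.symm e1
    refine (e2 e3).extend fun p hp hpn => ?_
    obtain rfl : p = k + 4 * m + 2 := by omega
    exact ⟨fun _ => e4, fun h => by omega⟩
  · obtain ⟨m, hm⟩ : ∃ m, n = k + 4 * m + 5 := ⟨(n - k - 5) / 4, by split_ifs at hr <;> omega⟩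
    obtain ⟨e1, e2⟩ := hmain m (by omega)
    obtain ⟨b1, b2⟩ := hT.odd_end (k + 4 * m + 2) (by omega) (by omega) (by omega)
    obtain ⟨e3, e4, e5, e6⟩ := hf.odd_end hA (k := k + 4 * m) h0 hμ1 (by omega) hm.symm b1 b2 e1
      (by
        -- A bridge at `k + 4 m + 3` excludes one at `k + 4 m + 1`, so the graph is ahead by then.
        intro hc
        have hc' : cut A (k + 4 * m + 1) ≠ 1 := fun h => by
          have := hA.three_le_cut_of_cut_eq_one h
          rw [show k + 4 * m + 1 + 2 = k + 4 * m + 3 from rfl] at this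
          omega
        have hfin : T (k + 4 * m + 2) + μ / 4 ≤ exitRatio A f (k + 4 * m) → μ ≤ 1 / 9 →
            μ / (6 - 2 * μ) < bridgeMap μ (exitRatio A f (k + 4 * m) - μ / 2) - μ / 2 := by
          intro h h9
          have h3 := lt_bridgeMap_of_advantage h0 h9 b1 b2
          have h4 := bridgeMap_le_bridgeMap hμ1 (x := T (k + 4 * m + 2) - μ / 2 + μ / 4)
            (y := exitRatio A f (k + 4 * m) - μ / 2) (by linarith) (by linarith)
          linarith
        rcases m with _ | m
        · rcases hadv hc' with ⟨h, hk4⟩ | ⟨h, hk2⟩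
          · refine hfin h ?_
            exact_mod_cast bound 9 hpar (by omega) (by norm_num)
          · -- Here `n = 7`, and no block precedes in which an advantage could arise.
            have h7 : μ ≤ 1 / 7 := by
              exact_mod_cast bound 7 hpar (by omega) (by norm_num)
            have h3 : μ / (6 - 2 * μ) < bridgeMap μ (T (k + 4 * 0 + 2) - μ / 2) - μ / 2 := by
              refine lt_bridgeMap_of_start h0 h7 ?_ b2
              rw [show k + 4 * 0 + 2 = k + 2 from rfl, h]
              exact startRatio_sub hμ1
            have h4 := bridgeMap_le_bridgeMap hμ1 b1.le
              (show T (k + 4 * 0 + 2) - μ / 2 ≤ exitRatio A f (k + 4 * 0) - μ / 2 by linarith)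
            linarith
        · have h11 : μ ≤ 1 / 11 := by
            exact_mod_cast bound 11 hpar (by omega) (by norm_num)
          have h9 : μ ≤ 1 / 9 := by linarith
          refine hfin (hf.chainRatio_add_le hA hT h0 h9 (by omega) (by omega) hrk
            (fun m hm => (hmain m hm).1) (fun h => (hadv h).imp And.left fun h => ⟨h.1, h11⟩) m
            (by omega) hc') h9)
    rw [hm]
    exact (e2 e3).extend_block (by omega) (by omega) e4 e5 e6

end IsSortedSubsolution

/-! ### The extremal chain -/

/-- The neighbours of the vertex `i` in the infinite chain from which `extremalGraph n` is cut
off. -/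
def chainNbrs (n i : ℕ) : Finset ℕ :=
  if n % 4 = 1 ∨ n % 4 = 2 then
    if i = 0 then {1, 2, 3}
    else if i = 2 ∨ i = 3 then {0, 1, 4}
    else if i % 4 = 1 ∨ i % 4 = 2 then {i - 1, i + 1, i + 2}
    else {i - 2, i - 1, i + 1}
  else
    if i = 0 then {1, 2, 3}
    else if i = 1 then {0, 2, 3}
    else if i = 2 then {0, 1, 4}
    else if i = 3 then {0, 1, 5}
    else if i = 4 then {2, 5, 6}
    else if i = 5 then {3, 4, 6}
    else if i % 4 = 3 ∨ i % 4 = 0 then {i - 1, i + 1, i + 2}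
    else {i - 2, i - 1, i + 1}

theorem exists_mem_blockEdges_iff (c i j : ℕ) :
    (∃ k : ℕ, (i, j) ∈ blockEdges (c + 4 * k)) ↔
      c ≤ i ∧ (j = i + 1 ∨ (j = i + 2 ∧ ((i - c) % 4 = 1 ∨ (i - c) % 4 = 2))) := by
  simp only [blockEdges, List.mem_cons, Prod.mk.injEq, List.not_mem_nil, or_false]
  constructor
  · rintro ⟨k, h⟩
    omega
  · intro h
    exact ⟨(i - c) / 4, by omega⟩

theorem mem_shortHead_iff (i j : ℕ) : (i, j) ∈ shortHead ↔
    (i = 0 ∧ (j = 1 ∨ j = 2 ∨ j = 3)) ∨ (i = 1 ∧ (j = 2 ∨ j = 3)) ∨ (i = 2 ∧ j = 4) ∨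
      (i = 3 ∧ j = 4) := by
  simp only [shortHead, List.mem_cons, Prod.mk.injEq, List.not_mem_nil, or_false]
  omega

theorem mem_longHead_iff (i j : ℕ) : (i, j) ∈ longHead ↔
    (i = 0 ∧ (j = 1 ∨ j = 2 ∨ j = 3)) ∨ (i = 1 ∧ (j = 2 ∨ j = 3)) ∨ (i = 2 ∧ j = 4) ∨
      (i = 3 ∧ j = 5) ∨ (i = 4 ∧ (j = 5 ∨ j = 6)) ∨ (i = 5 ∧ j = 6) := by
  simp only [longHead, List.mem_cons, Prod.mk.injEq, List.not_mem_nil, or_false]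
  omega

theorem extremalGraph_adj {n : ℕ} (i j : Fin n) :
    (extremalGraph n).Adj i j ↔ (j : ℕ) ∈ chainNbrs n i := by
  rw [extremalGraph, SimpleGraph.fromRel_adj, ne_eq, Fin.ext_iff]
  obtain ⟨i, hi⟩ := i
  obtain ⟨j, hj⟩ := j
  simp only [exists_mem_blockEdges_iff, mem_shortHead_iff, mem_longHead_iff]
  clear hi hj
  unfold chainNbrs
  by_cases h : n % 4 = 1 ∨ n % 4 = 2
  · simp only [h, if_true]
    clear h
    rcases Nat.lt_or_ge i 5 with hi | hi
    · interval_cases i <;> simp <;> omega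
    · rw [if_neg (by omega), if_neg (by omega)]
      constructor
      · rintro ⟨-, (hh | ⟨hc, hb⟩) | (hh | ⟨hc, hb⟩)⟩
        · omega
        · split_ifs <;> simp only [Finset.mem_insert, Finset.mem_singleton] <;> omega
        · omega
        · split_ifs <;> simp only [Finset.mem_insert, Finset.mem_singleton] <;> omega
      · intro hj
        have hj' : j = i - 1 ∨ j = i + 1 ∨ (j = i + 2 ∧ (i % 4 = 1 ∨ i % 4 = 2)) ∨
            (j = i - 2 ∧ ¬ (i % 4 = 1 ∨ i % 4 = 2)) := by
          split_ifs at hj <;> simp only [Finset.mem_insert, Finset.mem_singleton] at hj <;> omega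
        refine ⟨by omega, ?_⟩
        rcases hj' with hj | hj | hj | hj
        · exact Or.inr (Or.inr ⟨by omega, Or.inl (by omega)⟩)
        · exact Or.inl (Or.inr ⟨by omega, Or.inl (by omega)⟩)
        · exact Or.inl (Or.inr ⟨by omega, Or.inr ⟨by omega, by omega⟩⟩)
        · exact Or.inr (Or.inr ⟨by omega, Or.inr ⟨by omega, by omega⟩⟩)
  · simp only [h, if_false]
    clear h
    rcases Nat.lt_or_ge i 7 with hi | hi
    · interval_cases i <;> simp <;> omega
    · rw [if_neg (by omega), if_neg (by omega), if_neg (by omega), if_neg (by omega),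
        if_neg (by omega), if_neg (by omega)]
      constructor
      · rintro ⟨-, (hh | ⟨hc, hb⟩) | (hh | ⟨hc, hb⟩)⟩
        · omega
        · split_ifs <;> simp only [Finset.mem_insert, Finset.mem_singleton] <;> omega
        · omega
        · split_ifs <;> simp only [Finset.mem_insert, Finset.mem_singleton] <;> omega
      · intro hj
        have hj' : j = i - 1 ∨ j = i + 1 ∨ (j = i + 2 ∧ (i % 4 = 3 ∨ i % 4 = 0)) ∨
            (j = i - 2 ∧ ¬ (i % 4 = 3 ∨ i % 4 = 0)) := by
          split_ifs at hj <;> simp only [Finset.mem_insert, Finset.mem_singleton] at hj <;> omega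
        refine ⟨by omega, ?_⟩
        rcases hj' with hj | hj | hj | hj
        · exact Or.inr (Or.inr ⟨by omega, Or.inl (by omega)⟩)
        · exact Or.inl (Or.inr ⟨by omega, Or.inl (by omega)⟩)
        · exact Or.inl (Or.inr ⟨by omega, Or.inr ⟨by omega, by omega⟩⟩)
        · exact Or.inr (Or.inr ⟨by omega, Or.inr ⟨by omega, by omega⟩⟩)

theorem card_chainNbrs (n i : ℕ) : (chainNbrs n i).card = 3 := by
  unfold chainNbrs
  split_ifs <;> first | rfl | (refine Finset.card_eq_three.2 ⟨_, _, _, ?_, ?_, ?_, rfl⟩ <;> omega)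

theorem map_neighborFinset_extremalGraph {n : ℕ} (v : Fin n)
    [Fintype ((extremalGraph n).neighborSet v)] :
    ((extremalGraph n).neighborFinset v).map Fin.valEmbedding
      = (chainNbrs n v).filter (· < n) := by
  ext j
  simp only [Finset.mem_map, SimpleGraph.mem_neighborFinset, extremalGraph_adj,
    Fin.valEmbedding_apply, Finset.mem_filter]
  constructor
  · rintro ⟨a, ha, rfl⟩
    exact ⟨ha, a.2⟩
  · rintro ⟨h1, h2⟩
    exact ⟨⟨j, h2⟩, h1, rfl⟩

theorem degree_extremalGraph {n : ℕ} (v : Fin n) [Fintype ((extremalGraph n).neighborSet v)] :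
    (extremalGraph n).degree v = ((chainNbrs n v).filter (· < n)).card := by
  rw [← map_neighborFinset_extremalGraph, Finset.card_map, SimpleGraph.card_neighborFinset_eq_degree]

theorem degree_extremalGraph_le {n : ℕ} (v : Fin n) [Fintype ((extremalGraph n).neighborSet v)] :
    (extremalGraph n).degree v ≤ 3 := by
  rw [degree_extremalGraph, ← card_chainNbrs n v]
  exact Finset.card_filter_le _ _

theorem lt_of_mem_chainNbrs {n i : ℕ} (hn : 5 ≤ n) (hi : i + 1 < n) :
    ∀ j ∈ chainNbrs n i, j < n := by
  unfold chainNbrs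
  intro j hj
  split_ifs at hj <;> simp only [Finset.mem_insert, Finset.mem_singleton] at hj <;> omega

theorem degree_extremalGraph_of_lt {n : ℕ} (hn : 5 ≤ n) (v : Fin n) (hv : (v : ℕ) + 1 < n)
    [Fintype ((extremalGraph n).neighborSet v)] : (extremalGraph n).degree v = 3 := by
  rw [degree_extremalGraph, Finset.filter_true_of_mem (lt_of_mem_chainNbrs hn hv), card_chainNbrs]

theorem exists_mem_chainNbrs_lt (n : ℕ) {i : ℕ} (hi : 0 < i) : ∃ j ∈ chainNbrs n i, j < i := by
  refine ⟨if i ≤ 3 then 0 else if i = 4 ∧ ¬ (n % 4 = 1 ∨ n % 4 = 2) then 2 else i - 1, ?_, ?_⟩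
  · unfold chainNbrs
    split_ifs <;> simp only [Finset.mem_insert, Finset.mem_singleton, true_or, or_true] <;> omega
  · split_ifs <;> omega

theorem extremalGraph_connected {n : ℕ} (hn : 4 ≤ n) : (extremalGraph n).Connected := by
  have hreach : ∀ i (hi : i < n), (extremalGraph n).Reachable ⟨i, hi⟩ ⟨0, by omega⟩ := by
    intro i
    induction i using Nat.strong_induction_on with
    | _ i ih =>
      intro hi
      rcases Nat.eq_zero_or_pos i with rfl | h0
      · rfl
      · obtain ⟨j, hj, hji⟩ := exists_mem_chainNbrs_lt n h0
        have hadj : (extremalGraph n).Adj ⟨i, hi⟩ ⟨j, by omega⟩ := by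
          rw [extremalGraph_adj]; exact hj
        exact hadj.reachable.trans (ih j hji (by omega))
  have : Nonempty (Fin n) := ⟨⟨0, by omega⟩⟩
  exact ⟨fun u v => (hreach u u.2).trans (hreach v v.2).symm⟩

theorem exists_mem_chainNbrs_last_ge {n : ℕ} (hn : 4 ≤ n) : ∃ j ∈ chainNbrs n (n - 1), n ≤ j := by
  by_cases h4 : n = 4
  · subst h4
    exact ⟨5, by decide, by omega⟩
  · refine ⟨n, ?_, le_rfl⟩
    unfold chainNbrs
    split_ifs <;> simp only [Finset.mem_insert, Finset.mem_singleton] <;> omega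

theorem degree_extremalGraph_zero {n : ℕ} (hn : 4 ≤ n) (v : Fin n) (hv : (v : ℕ) = 0)
    [Fintype ((extremalGraph n).neighborSet v)] : (extremalGraph n).degree v = 3 := by
  rw [degree_extremalGraph, Finset.filter_true_of_mem, card_chainNbrs]
  rw [hv]
  unfold chainNbrs
  intro j
  simp only [if_true]
  split_ifs <;> simp only [Finset.mem_insert, Finset.mem_singleton] <;> omega

theorem degree_extremalGraph_last {n : ℕ} (hn : 4 ≤ n) (v : Fin n) (hv : (v : ℕ) = n - 1)
    [Fintype ((extremalGraph n).neighborSet v)] : (extremalGraph n).degree v < 3 := by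
  rw [degree_extremalGraph, ← card_chainNbrs n (n - 1), hv]
  obtain ⟨j, hj, hjn⟩ := exists_mem_chainNbrs_last_ge hn
  refine Finset.card_lt_card ⟨Finset.filter_subset _ _, fun h => ?_⟩
  have := h hj
  simp only [Finset.mem_filter] at this
  omega

theorem isConnectedNonregular_extremalGraph {n : ℕ} (hn : 4 ≤ n) :
    IsConnectedNonregular 3 (extremalGraph n) := by
  classical
  unfold IsConnectedNonregular
  refine ⟨extremalGraph_connected hn, ?_, ?_⟩
  · rintro ⟨d, hd⟩
    have h1 := hd ⟨0, by omega⟩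
    have h2 := hd ⟨n - 1, by omega⟩
    rw [degree_extremalGraph_zero hn _ rfl] at h1
    have h3 := degree_extremalGraph_last hn ⟨n - 1, by omega⟩ rfl
    omega
  · refine le_antisymm (SimpleGraph.maxDegree_le_of_forall_degree_le _ _ fun v =>
      degree_extremalGraph_le v) ?_
    have h := (extremalGraph n).degree_le_maxDegree ⟨0, by omega⟩
    rw [degree_extremalGraph_zero hn _ rfl] at h
    exact h

/-- The sum of the degrees of the extremal chain is `3 n - 1` for odd `n` and `3 n - 2` for even
`n`. Only the lower bound is needed, for testing the Rayleigh quotient. -/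
theorem sum_degree_extremalGraph {n : ℕ} (hn : 4 ≤ n) [DecidableRel (extremalGraph n).Adj] :
    3 * n ≤ ∑ v, (extremalGraph n).degree v + (if n % 2 = 1 then 1 else 2) := by
  by_cases h4 : n = 4
  · subst h4
    simp only [degree_extremalGraph]
    decide
  · obtain ⟨m, rfl⟩ : ∃ m, n = m + 1 := ⟨n - 1, by omega⟩
    rw [Fin.sum_univ_castSucc]
    have h1 : ∀ i : Fin m, (extremalGraph (m + 1)).degree i.castSucc = 3 := fun i =>
      degree_extremalGraph_of_lt (by omega) _ (by simp)
    simp only [h1, Finset.sum_const, Finset.card_univ, Fintype.card_fin, smul_eq_mul]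
    rw [degree_extremalGraph]
    simp only [Fin.val_last]
    have h2 : (if (m + 1) % 2 = 1 then 2 else 1)
        ≤ ((chainNbrs (m + 1) m).filter (· < m + 1)).card := by
      have hsub : (if (m + 1) % 2 = 1 then {m - 1, m - 2} else {m - 1} : Finset ℕ)
          ⊆ (chainNbrs (m + 1) m).filter (· < m + 1) := by
        intro j hj
        rw [Finset.mem_filter]
        unfold chainNbrs
        split_ifs at hj ⊢ <;> simp only [Finset.mem_insert, Finset.mem_singleton] at hj ⊢ <;> omega
      refine le_trans ?_ (Finset.card_le_card hsub)
      split_ifs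
      · rw [Finset.card_pair (by omega)]
      · simp
    split_ifs at h2 ⊢ <;> omega

/-! ### The Perron vector of the extremal chain -/

/-- A positive solution of the eigenvalue equation with eigenvalue `3 - μ` on the extremal chain,
extended by `0` beyond the last vertex. -/
structure IsChainEigenvector (n : ℕ) (μ : ℝ) (h : ℕ → ℝ) : Prop where
  pos : ∀ i < n, 0 < h i
  zero : ∀ i, n ≤ i → h i = 0
  eigen : ∀ i < n, (3 - μ) * h i = ∑ j ∈ chainNbrs n i, h j

/-- The flux of a function through the cuts of the extremal chain. In each block, with vertices
`p - 1, …, p + 2`, the two middle vertices `p` and `p + 1` carry the same value. -/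
structure IsChainFlux (n r : ℕ) (μ : ℝ) (h : ℕ → ℝ) : Prop where
  head_zero : h 0 = h 1
  head_two : h 2 = h 3
  head_drop : 2 * h 0 - 2 * h 2 = μ * h 0
  short_drop : r = 1 → h 3 - h 4 = μ * partialSum h 4 / 2 ∧ h 4 - h 5 = μ * partialSum h 5
  enter : ∀ p, 4 ≤ p → p % 4 = (r + 1) % 4 → p ≤ n →
    2 * h (p - 1) - h p - h (p + 1) = μ * partialSum h p
  middle : ∀ p, 4 ≤ p → p % 4 = (r + 1) % 4 → p + 1 < n →
    h p = h (p + 1) ∧ 2 * h (p + 1) - 2 * h (p + 2) = μ * partialSum h (p + 2)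
  leave : ∀ p, 4 ≤ p → p % 4 = (r + 1) % 4 → p + 2 < n →
    h (p + 2) - h (p + 3) = μ * partialSum h (p + 3)

theorem chainNbrs_of_left {n i : ℕ} (hi : (if n % 4 = 1 ∨ n % 4 = 2 then 4 else 6) ≤ i)
    (hm : if n % 4 = 1 ∨ n % 4 = 2 then i % 4 = 0 ∨ i % 4 = 1 else i % 4 = 2 ∨ i % 4 = 3) :
    chainNbrs n (i + 1) = {i, i + 2, i + 3} := by
  unfold chainNbrs
  by_cases h : n % 4 = 1 ∨ n % 4 = 2
  · simp only [h, if_true] at hi hm ⊢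
    rw [if_neg (by omega), if_neg (by omega), if_pos (by omega)]
    rfl
  · simp only [h, if_false] at hi hm ⊢
    rw [if_neg (by omega), if_neg (by omega), if_neg (by omega), if_neg (by omega),
      if_neg (by omega), if_neg (by omega), if_pos (by omega)]
    rfl

theorem chainNbrs_of_right {n i : ℕ} (hi : (if n % 4 = 1 ∨ n % 4 = 2 then 2 else 4) ≤ i)
    (hm : if n % 4 = 1 ∨ n % 4 = 2 then i % 4 = 1 ∨ i % 4 = 2 else i % 4 = 3 ∨ i % 4 = 0) :
    chainNbrs n (i + 2) = {i, i + 1, i + 3} := by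
  unfold chainNbrs
  by_cases h : n % 4 = 1 ∨ n % 4 = 2
  · simp only [h, if_true] at hi hm ⊢
    rw [if_neg (by omega), if_neg (by omega), if_neg (by omega)]
    rfl
  · simp only [h, if_false] at hi hm ⊢
    rw [if_neg (by omega), if_neg (by omega), if_neg (by omega), if_neg (by omega),
      if_neg (by omega), if_neg (by omega), if_neg (by omega)]
    rfl

theorem sum_triple {a b c : ℕ} (h : ℕ → ℝ) (hab : a ≠ b) (hac : a ≠ c) (hbc : b ≠ c) :
    ∑ j ∈ ({a, b, c} : Finset ℕ), h j = h a + h b + h c := by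
  rw [Finset.sum_insert (by simp [hab, hac]), Finset.sum_pair hbc, add_assoc]

namespace IsChainEigenvector

variable {n : ℕ} {μ : ℝ} {h : ℕ → ℝ} (H : IsChainEigenvector n μ h)
include H

theorem eigen_of_eq {i a b c : ℕ} (hi : i < n) (hN : chainNbrs n i = {a, b, c}) (hab : a ≠ b)
    (hac : a ≠ c) (hbc : b ≠ c) : (3 - μ) * h i = h a + h b + h c := by
  rw [H.eigen i hi, hN, sum_triple h hab hac hbc]

theorem block_eigen {r q : ℕ} (hr : r = if n % 4 = 1 ∨ n % 4 = 2 then 1 else 3) (hq : 4 ≤ q)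
    (hqr : (q + 2) % 4 = (r + 1) % 4) :
    (q + 1 < n → (3 - μ) * h (q + 1) = h q + h (q + 2) + h (q + 3)) ∧
    (q + 2 < n → (3 - μ) * h (q + 2) = h (q + 1) + h (q + 3) + h (q + 4)) ∧
    (q + 3 < n → (3 - μ) * h (q + 3) = h (q + 1) + h (q + 2) + h (q + 4)) ∧
    (q + 4 < n → (3 - μ) * h (q + 4) = h (q + 2) + h (q + 3) + h (q + 5)) := by
  refine ⟨fun hi => H.eigen_of_eq hi ?_ (by omega) (by omega) (by omega),
    fun hi => H.eigen_of_eq hi ?_ (by omega) (by omega) (by omega),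
    fun hi => H.eigen_of_eq hi ?_ (by omega) (by omega) (by omega),
    fun hi => H.eigen_of_eq hi ?_ (by omega) (by omega) (by omega)⟩
  · exact chainNbrs_of_left (i := q) (by split_ifs at hr ⊢ <;> omega)
      (by split_ifs at hr ⊢ <;> omega)
  · exact chainNbrs_of_left (i := q + 1) (by split_ifs at hr ⊢ <;> omega)
      (by split_ifs at hr ⊢ <;> omega)
  · exact chainNbrs_of_right (i := q + 1) (by split_ifs at hr ⊢ <;> omega)
      (by split_ifs at hr ⊢ <;> omega)
  · exact chainNbrs_of_right (i := q + 2) (by split_ifs at hr ⊢ <;> omega)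
      (by split_ifs at hr ⊢ <;> omega)

/-- The flux through one block, given the flux through the bridge in front of it. -/
theorem block_flux {r q : ℕ} (hμ : μ < 3) (hr : r = if n % 4 = 1 ∨ n % 4 = 2 then 1 else 3)
    (hq : 4 ≤ q) (hqr : (q + 2) % 4 = (r + 1) % 4) (hqn : q + 2 ≤ n)
    (hb : h q - h (q + 1) = μ * partialSum h (q + 1)) :
    (2 * h (q + 1) - h (q + 2) - h (q + 3) = μ * partialSum h (q + 2)) ∧
    (q + 3 < n → h (q + 2) = h (q + 3) ∧
      2 * h (q + 3) - 2 * h (q + 4) = μ * partialSum h (q + 4)) ∧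
    (q + 4 < n → h (q + 4) - h (q + 5) = μ * partialSum h (q + 5)) := by
  obtain ⟨e1, e2, e3, e4⟩ := H.block_eigen hr hq hqr
  have f1 : 2 * h (q + 1) - h (q + 2) - h (q + 3) = μ * partialSum h (q + 2) := by
    rw [partialSum_succ h (q + 1)]
    linear_combination hb + e1 (by omega)
  have f2 : q + 3 < n → h (q + 2) = h (q + 3) ∧
      2 * h (q + 3) - 2 * h (q + 4) = μ * partialSum h (q + 4) := by
    intro hi
    have e2 := e2 (by omega)
    have e3 := e3 hi
    have heq : (4 - μ) * (h (q + 2) - h (q + 3)) = 0 := by linear_combination e2 - e3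
    have heq' : h (q + 2) = h (q + 3) := by
      rcases mul_eq_zero.1 heq with h' | h' <;> linarith
    refine ⟨heq', ?_⟩
    rw [partialSum_succ h (q + 3), partialSum_succ h (q + 2)]
    rw [heq'] at f1 e3 ⊢
    linear_combination f1 + 2 * e3
  refine ⟨f1, f2, fun hi => ?_⟩
  obtain ⟨g1, g2⟩ := f2 (by omega)
  rw [partialSum_succ h (q + 4)]
  have e4 := e4 hi
  rw [g1] at e4
  linear_combination g2 + e4

theorem isChainFlux {r : ℕ} (hn : 4 ≤ n) (hr : r = if n % 4 = 1 ∨ n % 4 = 2 then 1 else 3)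
    (hμ : μ ≤ 1 / 2) : IsChainFlux n r μ h := by
  have e0 : (3 - μ) * h 0 = h 1 + h 2 + h 3 := by
    refine H.eigen_of_eq (by omega) ?_ (by omega) (by omega) (by omega)
    by_cases hs : n % 4 = 1 ∨ n % 4 = 2 <;> simp [chainNbrs, hs]
  have e1 : (3 - μ) * h 1 = h 0 + h 2 + h 3 := by
    refine H.eigen_of_eq (by omega) ?_ (by omega) (by omega) (by omega)
    by_cases hs : n % 4 = 1 ∨ n % 4 = 2 <;> simp [chainNbrs, hs]
  have e2 : (3 - μ) * h 2 = h 0 + h 1 + h 4 := by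
    refine H.eigen_of_eq (by omega) ?_ (by omega) (by omega) (by omega)
    by_cases hs : n % 4 = 1 ∨ n % 4 = 2 <;> simp [chainNbrs, hs]
  have h01 : h 0 = h 1 := by
    have : (4 - μ) * (h 0 - h 1) = 0 := by linear_combination e0 - e1
    rcases mul_eq_zero.1 this with h' | h' <;> linarith
  have F4 : partialSum h 4 = h 0 + h 1 + h 2 + h 3 := by
    simp [partialSum, Finset.sum_range_succ]
  have F5 : partialSum h 5 = h 0 + h 1 + h 2 + h 3 + h 4 := by
    simp [partialSum, Finset.sum_range_succ]
  -- It remains to treat the head; the blocks follow by induction.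
  suffices hhead : h 2 = h 3 ∧
      (r = 1 → h 3 - h 4 = μ * partialSum h 4 / 2 ∧ h 4 - h 5 = μ * partialSum h 5) ∧
      (r = 3 → 2 * h 3 - h 4 - h 5 = μ * partialSum h 4 ∧
        (5 < n → h 4 = h 5 ∧ 2 * h 5 - 2 * h 6 = μ * partialSum h 6) ∧
        (6 < n → h 6 - h 7 = μ * partialSum h 7)) by
    obtain ⟨h23, hs, hl⟩ := hhead
    have hblock : ∀ i q, q = (if r = 1 then 4 else 6) + 4 * i → q + 2 ≤ n →
        h q - h (q + 1) = μ * partialSum h (q + 1) := by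
      intro i
      induction i with
      | zero =>
        intro q hq hqn
        by_cases hr1 : r = 1
        · rw [if_pos hr1] at hq
          obtain rfl : q = 4 := by omega
          exact (hs hr1).2
        · have hr3 : r = 3 := by split_ifs at hr <;> omega
          rw [if_neg hr1] at hq
          obtain rfl : q = 6 := by omega
          exact (hl hr3).2.2 (by omega)
      | succ i ih =>
        intro q hq hqn
        obtain ⟨q, rfl⟩ : ∃ q', q = q' + 4 := ⟨q - 4, by split_ifs at hq <;> omega⟩
        have hb := ih q (by omega) (by omega)
        exact (H.block_flux (r := r) (by linarith) hr (by split_ifs at hq <;> omega)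
          (by split_ifs at hq hr <;> omega) (by omega) hb).2.2
          (by omega)
    have hgen : ∀ p, 4 ≤ p → p % 4 = (r + 1) % 4 → p ≤ n → ¬ (r = 3 ∧ p = 4) →
        (2 * h (p - 1) - h p - h (p + 1) = μ * partialSum h p) ∧
        (p + 1 < n → h p = h (p + 1) ∧
          2 * h (p + 1) - 2 * h (p + 2) = μ * partialSum h (p + 2)) ∧
        (p + 2 < n → h (p + 2) - h (p + 3) = μ * partialSum h (p + 3)) := by
      intro p hp hpr hpn hne
      obtain ⟨q, rfl⟩ : ∃ q, p = q + 2 := ⟨p - 2, by omega⟩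
      have hr13 : r = 1 ∨ r = 3 := by split_ifs at hr <;> omega
      have hb := hblock ((q - if r = 1 then 4 else 6) / 4) q (by split_ifs <;> omega) hpn
      exact H.block_flux (r := r) (by linarith) hr (by omega) hpr hpn hb
    refine ⟨h01, h23, ?_, hs, ?_, ?_, ?_⟩
    · rw [h01] at e0 ⊢
      rw [h23] at e0 ⊢
      linear_combination e0
    · intro p hp hpr hpn
      by_cases hne : r = 3 ∧ p = 4
      · obtain ⟨hr3, rfl⟩ := hne
        exact (hl hr3).1
      · exact (hgen p hp hpr hpn hne).1
    · intro p hp hpr hpn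
      by_cases hne : r = 3 ∧ p = 4
      · obtain ⟨hr3, rfl⟩ := hne
        exact (hl hr3).2.1 hpn
      · exact (hgen p hp hpr (by omega) hne).2.1 hpn
    · intro p hp hpr hpn
      by_cases hne : r = 3 ∧ p = 4
      · obtain ⟨hr3, rfl⟩ := hne
        exact (hl hr3).2.2 hpn
      · exact (hgen p hp hpr (by omega) hne).2.2 hpn
  by_cases hshort : n % 4 = 1 ∨ n % 4 = 2
  · obtain rfl : r = 1 := by rw [hr, if_pos hshort]
    have e3 : (3 - μ) * h 3 = h 0 + h 1 + h 4 := by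
      refine H.eigen_of_eq (by omega) ?_ (by omega) (by omega) (by omega)
      simp [chainNbrs, hshort]
    have e4 : (3 - μ) * h 4 = h 2 + h 3 + h 5 := by
      refine H.eigen_of_eq (by omega) ?_ (by omega) (by omega) (by omega)
      simp [chainNbrs, hshort]
    have h23 : h 2 = h 3 := by
      have : (3 - μ) * (h 2 - h 3) = 0 := by linear_combination e2 - e3
      rcases mul_eq_zero.1 this with h' | h' <;> linarith
    refine ⟨h23, fun _ => ⟨?_, ?_⟩, fun h => by omega⟩
    · simp only [F4, h01, h23] at e0 e3 ⊢
      linear_combination e3 + e0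
    · simp only [F5, h01, h23] at e0 e3 e4 ⊢
      linear_combination e4 + 2 * e3 + 2 * e0
  · obtain rfl : r = 3 := by rw [hr, if_neg hshort]
    have e3 : (3 - μ) * h 3 = h 0 + h 1 + h 5 := by
      refine H.eigen_of_eq (by omega) ?_ (by omega) (by omega) (by omega)
      simp [chainNbrs, hshort]
    have e4 : 4 < n → (3 - μ) * h 4 = h 2 + h 5 + h 6 := by
      intro hi
      refine H.eigen_of_eq hi ?_ (by omega) (by omega) (by omega)
      simp [chainNbrs, hshort]
    have e5 : 5 < n → (3 - μ) * h 5 = h 3 + h 4 + h 6 := by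
      intro hi
      refine H.eigen_of_eq hi ?_ (by omega) (by omega) (by omega)
      simp [chainNbrs, hshort]
    have e6 : 6 < n → (3 - μ) * h 6 = h 4 + h 5 + h 7 := by
      intro hi
      refine H.eigen_of_eq hi ?_ (by omega) (by omega) (by omega)
      simp [chainNbrs, hshort]
    have h2345 : h 2 = h 3 ∧ h 4 = h 5 := by
      have d1 : (3 - μ) * (h 2 - h 3) = h 4 - h 5 := by linear_combination e2 - e3
      have h45 : h 4 = h 5 := by
        by_cases h4 : n = 4
        · rw [H.zero 4 h4.le, H.zero 5 (by omega)]
        · have d2 : (4 - μ) * (h 4 - h 5) = h 2 - h 3 := by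
            linear_combination e4 (by omega) - e5 (by omega)
          have d3 : ((4 - μ) * (3 - μ) - 1) * (h 4 - h 5) = 0 := by
            linear_combination (3 - μ) * d2 + d1
          rcases mul_eq_zero.1 d3 with h' | h'
          · nlinarith
          · linarith
      refine ⟨?_, h45⟩
      rw [h45, sub_self] at d1
      rcases mul_eq_zero.1 d1 with h' | h' <;> linarith
    obtain ⟨h23, h45⟩ := h2345
    have F6 : partialSum h 6 = h 0 + h 1 + h 2 + h 3 + h 4 + h 5 := by
      simp [partialSum, Finset.sum_range_succ]
    have F7 : partialSum h 7 = h 0 + h 1 + h 2 + h 3 + h 4 + h 5 + h 6 := by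
      simp [partialSum, Finset.sum_range_succ]
    refine ⟨h23, fun h => by omega, fun _ => ⟨?_, fun hi => ⟨h45, ?_⟩, fun hi => ?_⟩⟩
    · simp only [F4, h01, h23] at e0 e2 e3 ⊢
      linear_combination e2 + e3 + 2 * e0
    · have e5 := e5 hi
      simp only [F6, h01, h23, h45] at e0 e2 e3 e5 ⊢
      linear_combination e2 + e3 + 2 * e0 + 2 * e5
    · have e5 := e5 (by omega)
      have e6 := e6 hi
      simp only [F7, h01, h23, h45] at e0 e2 e3 e5 e6 ⊢
      linear_combination e2 + e3 + 2 * e0 + 2 * e5 + e6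

end IsChainEigenvector

/-! ### The ratios of the extremal chain -/

namespace IsChainFlux

variable {n r : ℕ} {μ : ℝ} {h : ℕ → ℝ}

/-- In the extremal chain the flux inequalities are equalities, so its ratios follow the two Möbius
maps exactly. -/
theorem isChainRatio (H : IsChainFlux n r μ h) (hn : 4 ≤ n)
    (hr : r = if n % 4 = 1 ∨ n % 4 = 2 then 1 else 3) (hμ : μ < 1)
    (hpos : ∀ i < n, 0 < h i) (hzero : ∀ i, n ≤ i → h i = 0) :
    IsChainRatio n r μ fun p => h (p - 1) / partialSum h p := by
  have hF : ∀ p, 1 ≤ p → 0 < partialSum h p := fun p hp =>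
    (hpos 0 (by omega)).trans_le (Finset.single_le_sum (f := h) (fun i _ => by
      rcases lt_or_ge i n with h' | h'
      · exact (hpos i h').le
      · exact (hzero i h').ge) (Finset.mem_range.2 (by omega)))
  -- A drop of `μ / 2` times the partial sum, in terms of ratios.
  have cut_two : ∀ {a b F : ℝ}, 0 < F → 2 * a - 2 * b = μ * F → a / F - μ / 2 = b / F := by
    intro a b F hF' hab
    rw [div_sub' hF'.ne', div_left_inj' hF'.ne']
    linarith
  have rung : ∀ {b F : ℝ}, 0 < F → rungMap (b / F) = b / (F + b + b) := by
    intro b F hF'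
    unfold rungMap
    rw [show F + b + b = F * (1 + 2 * (b / F)) by field_simp; ring, div_mul_eq_div_div]
  have bridge : ∀ {b c F : ℝ}, 0 < F → b - c = μ * (F + b) →
      bridgeMap μ (b / F) = c / (F + b + c) := by
    intro b c F hF' hbc
    obtain rfl : c = b - μ * (F + b) := by linarith
    unfold bridgeMap
    rw [show (1 - μ) * (b / F) - μ = (b - μ * (F + b)) / F by field_simp; ring,
      show (2 - μ) * (b / F) + (1 - μ) = (F + b + (b - μ * (F + b))) / F by field_simp; ring,
      div_div_div_cancel_right₀ hF'.ne']
  have F2 : partialSum h 2 = h 0 + h 1 := by simp [partialSum, Finset.sum_range_succ]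
  have hstart : h 3 / partialSum h 4 = startRatio μ := by
    have e1 : (1 / 2 - μ / 4) = h 3 / partialSum h 2 := by
      rw [eq_div_iff (hF 2 (by omega)).ne', F2, ← H.head_zero, ← H.head_two]
      linear_combination (1 / 2) * H.head_drop
    rw [startRatio, e1, rung (hF 2 (by omega)), partialSum_succ, partialSum_succ, H.head_two]
  have hshort : r = 1 → 5 ≤ n → h 3 / partialSum h 4 - μ / 2 = h 4 / partialSum h 4 := by
    intro h1 _
    exact cut_two (hF 4 (by omega)) (by linarith [(H.short_drop h1).1])
  refine ⟨hstart, ?_, ?_, ?_, ?_, ?_⟩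
  · intro h1 h6
    show 0 < h 3 / partialSum h 4 - μ / 2 ∧
      h 5 / partialSum h 6 = bridgeMap μ (h 3 / partialSum h 4 - μ / 2)
    have hd := (H.short_drop h1).2
    rw [partialSum_succ] at hd
    rw [hshort h1 (by omega), bridge (hF 4 (by omega)) hd, partialSum_succ h 5, partialSum_succ h 4]
    exact ⟨div_pos (hpos 4 (by omega)) (hF 4 (by omega)), rfl⟩
  · intro p hp hpr hpn
    simp only [show p + 4 - 1 = p + 3 from rfl]
    have e1 := H.enter p hp hpr (by omega)
    obtain ⟨e2, e3⟩ := H.middle p hp hpr (by omega)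
    have e4 := H.leave p hp hpr (by omega)
    rw [← e2] at e1 e3
    rw [partialSum_succ] at e4
    have hFp := hF p (by omega)
    have hFp2 := hF (p + 2) (by omega)
    have s : partialSum h (p + 2) = partialSum h p + h p + h p := by
      rw [partialSum_succ, partialSum_succ, ← e2]
    have x1 : h (p - 1) / partialSum h p - μ / 2 = h p / partialSum h p :=
      cut_two hFp (by linarith)
    have x2 : rungMap (h p / partialSum h p) - μ / 2 = h (p + 2) / partialSum h (p + 2) := by
      rw [rung hFp, ← s]
      exact cut_two hFp2 e3
    rw [x1, x2, bridge hFp2 e4, partialSum_succ h (p + 3), partialSum_succ h (p + 2)]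
    refine ⟨div_pos (hpos p (by omega)) hFp, div_pos (hpos _ (by omega)) hFp2, rfl,
      div_pos (hpos _ (by omega)) ?_⟩
    linarith [hpos (p + 2) (by omega), hpos (p + 3) (by omega)]
  · intro he
    have e1 := H.enter n hn (by split_ifs at hr <;> omega) le_rfl
    rw [hzero n le_rfl, hzero (n + 1) (by omega)] at e1
    show h (n - 1) / partialSum h n = μ / 2
    rw [div_eq_iff (hF n (by omega)).ne']
    linarith
  · intro p hp hpr hpn
    have e1 := H.enter p hp hpr (by omega)
    obtain ⟨e2, e3⟩ := H.middle p hp hpr (by omega)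
    have e4 := H.leave p hp hpr (by omega)
    rw [← e2] at e1 e3
    rw [partialSum_succ, hzero (p + 3) hpn.ge, sub_zero] at e4
    have hFp := hF p (by omega)
    have hFp2 := hF (p + 2) (by omega)
    have s : partialSum h (p + 2) = partialSum h p + h p + h p := by
      rw [partialSum_succ, partialSum_succ, ← e2]
    have x1 : h (p - 1) / partialSum h p - μ / 2 = h p / partialSum h p :=
      cut_two hFp (by linarith)
    have x2 : rungMap (h p / partialSum h p) - μ / 2 = h (p + 2) / partialSum h (p + 2) := by
      rw [rung hFp, ← s]
      exact cut_two hFp2 e3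
    rw [x1, x2, div_eq_div_iff hFp2.ne' (by linarith)]
    exact ⟨div_pos (hpos p (by omega)) hFp, by linarith⟩
  · intro h5
    have h1 : r = 1 := by rw [hr, if_pos (by omega)]
    show h 3 / partialSum h 4 - μ / 2 = μ / (1 - μ)
    have hd := (H.short_drop h1).2
    rw [hzero 5 h5.le, partialSum_succ] at hd
    rw [hshort h1 h5.ge, div_eq_div_iff (hF 4 (by omega)).ne' (by linarith)]
    linarith

/-- The flux at the end of the chain, where the vector vanishes beyond the last vertex, is
positive. -/
theorem mu_pos (H : IsChainFlux n r μ h) (hn : 4 ≤ n)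
    (hr : r = if n % 4 = 1 ∨ n % 4 = 2 then 1 else 3)
    (hpos : ∀ i < n, 0 < h i) (hzero : ∀ i, n ≤ i → h i = 0) : 0 < μ := by
  have hF : ∀ p, 1 ≤ p → 0 < partialSum h p := fun p hp =>
    (hpos 0 (by omega)).trans_le (Finset.single_le_sum (f := h) (fun i _ => by
      rcases lt_or_ge i n with h' | h'
      · exact (hpos i h').le
      · exact (hzero i h').ge) (Finset.mem_range.2 (by omega)))
  suffices 0 < μ * partialSum h n from pos_of_mul_pos_left this (hF n (by omega)).le
  have hlast := hpos (n - 1) (by omega)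
  rcases Nat.mod_two_eq_zero_or_one n with he | ho
  · have e1 := H.enter n hn (by split_ifs at hr <;> omega) le_rfl
    rw [hzero n le_rfl, hzero (n + 1) (by omega)] at e1
    linarith
  · by_cases h5 : n = 5
    · subst h5
      have hd := (H.short_drop (by simpa using hr)).2
      rw [hzero 5 le_rfl] at hd
      have : 0 < h 4 := hlast
      linarith
    · obtain ⟨p, rfl⟩ : ∃ p, n = p + 3 := ⟨n - 3, by omega⟩
      have e4 := H.leave p (by omega) (by split_ifs at hr <;> omega) (by omega)
      rw [hzero (p + 3) le_rfl] at e4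
      have : 0 < h (p + 2) := hlast
      linarith

end IsChainFlux

/-! ### The cuts determine the graph -/

section Relabel

variable {σ : Equiv.Perm ℕ} (hσ : ∀ i, 4 ≤ i → σ i = i)
include hσ

theorem perm_lt_iff_of_fixes {p : ℕ} (hp : 4 ≤ p) (i : ℕ) : σ i < p ↔ i < p := by
  have h1 : 4 ≤ σ i → σ i = i := fun h => σ.injective (hσ _ h)
  have h2 := hσ i
  omega

theorem sum_range_comp_perm {M : Type*} [AddCommMonoid M] {p : ℕ} (hp : 4 ≤ p) (g : ℕ → M) :
    ∑ i ∈ Finset.range p, g (σ i) = ∑ i ∈ Finset.range p, g i :=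
  Finset.sum_equiv σ (fun i => by simp [perm_lt_iff_of_fixes hσ hp]) fun _ _ => rfl

/-- Permuting the first four vertices does not change the later cuts. -/
theorem cut_relabel {A : ℕ → ℕ → ℤ} {p : ℕ} (hp : 4 ≤ p) :
    cut (fun i j => A (σ i) (σ j)) p = cut A p := by
  unfold cut
  rw [← sum_range_comp_perm hσ hp fun i => 3 - ∑ j ∈ Finset.range p, A i j]
  exact Finset.sum_congr rfl fun i _ => by rw [sum_range_comp_perm hσ hp fun j => A (σ i) j]

theorem HasChainCuts.relabel {A : ℕ → ℕ → ℤ} {r k : ℕ} (h : HasChainCuts A r k) :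
    HasChainCuts (fun i j => A (σ i) (σ j)) r k := fun p hp hpk => by
  rw [cut_relabel hσ hp]
  exact h p hp hpk

theorem IsSubcubicGraph.relabel {n : ℕ} {A : ℕ → ℕ → ℤ} (hA : IsSubcubicGraph n A) (hn : 4 ≤ n) :
    IsSubcubicGraph n fun i j => A (σ i) (σ j) where
  symm _ _ := hA.symm _ _
  zero_or_one _ _ := hA.zero_or_one _ _
  diag _ := hA.diag _
  supp i j hj := by rw [hσ j (hn.trans hj)]; exact hA.supp _ _ hj
  deg_le i := by rw [sum_range_comp_perm hσ hn (fun j => A (σ i) j)]; exact hA.deg_le _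

end Relabel

namespace IsSubcubicGraph

variable {n : ℕ} {A : ℕ → ℕ → ℤ} (hA : IsSubcubicGraph n A)
include hA

theorem sum_four_nbrsBelow_le_cut (p : ℕ) :
    nbrsBelow A p p + nbrsBelow A p (p + 1) + nbrsBelow A p (p + 2) + nbrsBelow A p (p + 3)
      ≤ cut A p := by
  have h := hA.sum_nbrsBelow_le_cut p (p + 4)
  rw [Finset.sum_Ico_eq_sum_range, show p + 4 - p = 4 by omega] at h
  simpa [Finset.sum_range_succ] using h

/-- The bridge that leaves the vertex `q`. -/
theorem bridge_of_cuts {q : ℕ} (h0 : cut A q = 2) (h1 : cut A (q + 1) = 1)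
    (h2 : cut A (q + 2) = 2) : A (q + 1) q = 1 := by
  have a0 := hA.cut_succ q
  have a1 := hA.cut_succ (q + 1)
  have a2 := hA.nbrsBelow_add_le_cut q
  have a3 := nbrsBelow_succ A q (q + 1)
  have a4 := hA.nbrsBelow_nonneg q (q + 1)
  rw [show q + 1 + 1 = q + 2 from rfl] at a1
  omega

/-- Four vertices between two consecutive bridges span `K₄` minus an edge. -/
theorem block_of_cuts {q : ℕ} (h0 : cut A q = 2) (h1 : cut A (q + 1) = 1)
    (h2 : cut A (q + 2) = 2) (h4 : cut A (q + 4) = 2) (h5 : cut A (q + 5) = 1) :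
    A (q + 2) (q + 1) = 1 ∧ A (q + 3) (q + 1) = 1 ∧ A (q + 3) (q + 2) = 1 ∧
      A (q + 4) (q + 2) = 1 ∧ A (q + 4) (q + 3) = 1 := by
  have hb := hA.bridge_of_cuts h0 h1 h2
  have a1 := hA.cut_succ (q + 1)
  have a2 := hA.cut_succ (q + 2)
  have a3 := hA.cut_succ (q + 3)
  have a4 := hA.cut_succ (q + 4)
  have b1 := hA.sum_four_nbrsBelow_le_cut (q + 1)
  have b2 := hA.sum_four_nbrsBelow_le_cut (q + 2)
  have c2 := nbrsBelow_succ A (q + 1) (q + 2)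
  have c3 := nbrsBelow_succ A (q + 1) (q + 3)
  have c3' := nbrsBelow_succ A (q + 2) (q + 3)
  have c4 := nbrsBelow_succ A (q + 1) (q + 4)
  have c4' := nbrsBelow_succ A (q + 2) (q + 4)
  have c4'' := nbrsBelow_succ A (q + 3) (q + 4)
  have d2 := hA.nbrsBelow_nonneg (q + 1) (q + 2)
  have d3 := hA.nbrsBelow_nonneg (q + 1) (q + 3)
  have d4 := hA.nbrsBelow_nonneg (q + 1) (q + 4)
  have d5 := hA.nbrsBelow_nonneg (q + 2) (q + 5)
  have e1 := hA.le_one (q + 2) (q + 1)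
  have e2 := hA.le_one (q + 3) (q + 1)
  have e3 := hA.le_one (q + 3) (q + 2)
  have e4 := hA.le_one (q + 4) (q + 2)
  have e5 := hA.le_one (q + 4) (q + 3)
  have e6 := hA.nonneg (q + 4) (q + 1)
  simp only [add_assoc, Nat.reduceAdd] at *
  omega

/-- After a permutation of the first four vertices these span `K₄` minus the edge `{2, 3}`. -/
theorem exists_perm_head (h4 : cut A 4 = 2) :
    ∃ σ : Equiv.Perm ℕ, (∀ i, 4 ≤ i → σ i = i) ∧
      A (σ 1) (σ 0) = 1 ∧ A (σ 2) (σ 0) = 1 ∧ A (σ 2) (σ 1) = 1 ∧ A (σ 3) (σ 0) = 1 ∧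
        A (σ 3) (σ 1) = 1 ∧ A (σ 3) (σ 2) = 0 := by
  have hsum : A 1 0 + A 2 0 + A 2 1 + A 3 0 + A 3 1 + A 3 2 = 5 := by
    have a1 := hA.cut_succ 1
    have a2 := hA.cut_succ 2
    have a3 := hA.cut_succ 3
    have a0 := hA.cut_one
    simp only [nbrsBelow, Finset.sum_range_succ, Finset.sum_range_zero, Nat.reduceAdd] at a1 a2 a3
    omega
  have key : ∀ σ : Equiv.Perm ℕ, (∀ i, 4 ≤ i → σ i = i) → A (σ 3) (σ 2) = 0 →
      A (σ 1) (σ 0) + A (σ 2) (σ 0) + A (σ 2) (σ 1) + A (σ 3) (σ 0) + A (σ 3) (σ 1)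
        + A (σ 3) (σ 2) = 5 → ∃ σ : Equiv.Perm ℕ, (∀ i, 4 ≤ i → σ i = i) ∧
      A (σ 1) (σ 0) = 1 ∧ A (σ 2) (σ 0) = 1 ∧ A (σ 2) (σ 1) = 1 ∧ A (σ 3) (σ 0) = 1 ∧
        A (σ 3) (σ 1) = 1 ∧ A (σ 3) (σ 2) = 0 := by
    intro σ hσ h0 h5
    refine ⟨σ, hσ, ?_⟩
    have := hA.le_one (σ 1) (σ 0)
    have := hA.le_one (σ 2) (σ 0)
    have := hA.le_one (σ 2) (σ 1)
    have := hA.le_one (σ 3) (σ 0)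
    have := hA.le_one (σ 3) (σ 1)
    omega
  have hfix : ∀ {a b : ℕ}, a < 4 → b < 4 → ∀ i, 4 ≤ i → Equiv.swap a b i = i := fun ha hb i hi =>
    Equiv.swap_apply_of_ne_of_ne (by omega) (by omega)
  have h01 := hA.symm 0 1
  have h02 := hA.symm 0 2
  have h03 := hA.symm 0 3
  have h12 := hA.symm 1 2
  have h13 := hA.symm 1 3
  have h23 := hA.symm 2 3
  have hor : A 3 2 = 0 ∨ A 3 0 = 0 ∨ A 3 1 = 0 ∨ A 2 0 = 0 ∨ A 2 1 = 0 ∨ A 1 0 = 0 := by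
    by_contra! hne
    obtain ⟨n1, n2, n3, n4, n5, n6⟩ := hne
    have := (hA.zero_or_one 3 2).resolve_left n1
    have := (hA.zero_or_one 3 0).resolve_left n2
    have := (hA.zero_or_one 3 1).resolve_left n3
    have := (hA.zero_or_one 2 0).resolve_left n4
    have := (hA.zero_or_one 2 1).resolve_left n5
    have := (hA.zero_or_one 1 0).resolve_left n6
    omega
  rcases hor with h | h | h | h | h | h
  · exact key 1 (fun i _ => rfl) h hsum
  · refine key (Equiv.swap 0 2) (hfix (by norm_num) (by norm_num)) ?_ ?_ <;>
      simp only [Equiv.swap_apply_def] <;> norm_num <;> omega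
  · refine key (Equiv.swap 1 2) (hfix (by norm_num) (by norm_num)) ?_ ?_ <;>
      simp only [Equiv.swap_apply_def] <;> norm_num <;> omega
  · refine key (Equiv.swap 0 3) (hfix (by norm_num) (by norm_num)) ?_ ?_ <;>
      simp only [Equiv.swap_apply_def] <;> norm_num <;> omega
  · refine key (Equiv.swap 1 3) (hfix (by norm_num) (by norm_num)) ?_ ?_ <;>
      simp only [Equiv.swap_apply_def] <;> norm_num <;> omega
  · refine key (Equiv.swap 0 2 * Equiv.swap 1 3) (fun i hi => ?_) ?_ ?_
    · rw [Equiv.Perm.mul_apply, hfix (by norm_num) (by norm_num) i hi,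
        hfix (by norm_num) (by norm_num) i hi]
    all_goals simp only [Equiv.Perm.mul_apply, Equiv.swap_apply_def]; norm_num; omega

/-- The vertex `4` closes the short head. -/
theorem short_head_of_cuts (h10 : A 1 0 = 1) (h20 : A 2 0 = 1) (h21 : A 2 1 = 1) (h30 : A 3 0 = 1)
    (h31 : A 3 1 = 1) (h4 : cut A 4 = 2) (h5 : cut A 5 = 1) : A 4 2 = 1 ∧ A 4 3 = 1 := by
  have a4 := hA.cut_succ 4
  have d0 := hA.nbrsBelow_le_three (p := 5) 0
  have d1 := hA.nbrsBelow_le_three (p := 5) 1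
  simp only [nbrsBelow, Finset.sum_range_succ, Finset.sum_range_zero, Nat.reduceAdd, hA.diag]
    at a4 d0 d1
  have := hA.symm 0 1
  have := hA.symm 0 2
  have := hA.symm 0 3
  have := hA.symm 0 4
  have := hA.symm 1 2
  have := hA.symm 1 3
  have := hA.symm 1 4
  have := hA.le_one 4 2
  have := hA.le_one 4 3
  omega

/-- The triangle on `4, 5, 6` of the long head, attached to the vertices `2` and `3` in one of the
two possible ways. -/
theorem long_head_of_cuts (h10 : A 1 0 = 1) (h20 : A 2 0 = 1) (h21 : A 2 1 = 1) (h30 : A 3 0 = 1)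
    (h31 : A 3 1 = 1) (h4 : cut A 4 = 2) (h6 : cut A 6 = 2) (h7 : cut A 7 = 1) :
    A 5 4 = 1 ∧ A 6 4 = 1 ∧ A 6 5 = 1 ∧
      ((A 4 2 = 1 ∧ A 5 3 = 1) ∨ (A 4 3 = 1 ∧ A 5 2 = 1)) := by
  have a4 := hA.cut_succ 4
  have a5 := hA.cut_succ 5
  have a6 := hA.cut_succ 6
  have d0 := hA.nbrsBelow_le_three (p := 7) 0
  have d1 := hA.nbrsBelow_le_three (p := 7) 1
  have d2 := hA.nbrsBelow_le_three (p := 7) 2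
  have d3 := hA.nbrsBelow_le_three (p := 7) 3
  have d4 := hA.nbrsBelow_le_three (p := 7) 4
  have d5 := hA.nbrsBelow_le_three (p := 7) 5
  simp only [nbrsBelow, Finset.sum_range_succ, Finset.sum_range_zero, Nat.reduceAdd, hA.diag,
    hA.symm 0 _, hA.symm 1 2, hA.symm 1 3, hA.symm 1 4, hA.symm 1 5, hA.symm 1 6, hA.symm 2 3,
    hA.symm 2 4, hA.symm 2 5, hA.symm 2 6, hA.symm 3 4, hA.symm 3 5, hA.symm 3 6, hA.symm 4 5,
    hA.symm 4 6, hA.symm 5 6, h10, h20, h21, h30, h31] at a4 a5 a6 d0 d1 d2 d3 d4 d5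
  have n1 := hA.nonneg 4 0
  have n2 := hA.nonneg 5 0
  have n3 := hA.nonneg 6 0
  have n4 := hA.nonneg 4 1
  have n5 := hA.nonneg 5 1
  have n6 := hA.nonneg 6 1
  have n7 := hA.nonneg 6 2
  have n8 := hA.nonneg 6 3
  have n9 := hA.nonneg 3 2
  have l1 := hA.le_one 5 4
  have l2 := hA.le_one 6 4
  have l3 := hA.le_one 6 5
  have l4 := hA.nonneg 4 2
  have l5 := hA.nonneg 4 3
  have l6 := hA.nonneg 5 2
  have l7 := hA.nonneg 5 3
  have l8 := hA.le_one 4 2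
  have l9 := hA.le_one 4 3
  have : A 4 0 = 0 := by omega
  have : A 5 0 = 0 := by omega
  have : A 6 0 = 0 := by omega
  have : A 4 1 = 0 := by omega
  have : A 5 1 = 0 := by omega
  have : A 6 1 = 0 := by omega
  omega

end IsSubcubicGraph

section Structure

variable {n r : ℕ} {A : ℕ → ℕ → ℤ}

/-- The edges of the extremal chain are present in a graph with the same cuts, once the vertices
of the head are numbered suitably. -/
theorem IsSubcubicGraph.eq_one_of_extremalGraph_adj (hA : IsSubcubicGraph n A)
    (hcuts : HasChainCuts A r n) (hr : r = if n % 4 = 1 ∨ n % 4 = 2 then 1 else 3)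
    (h10 : A 1 0 = 1) (h20 : A 2 0 = 1) (h21 : A 2 1 = 1) (h30 : A 3 0 = 1) (h31 : A 3 1 = 1)
    (hlong : r = 3 → 7 ≤ n → A 4 2 = 1) {i j : Fin n} (h : (extremalGraph n).Adj i j) :
    A i j = 1 := by
  have two : ∀ p, 4 ≤ p → p ≤ n → p % 2 = 0 → cut A p = 2 := fun p h1 h2 => (hcuts p h1 h2).1
  have one : ∀ p, 4 ≤ p → p ≤ n → p % 4 = r → cut A p = 1 := fun p h1 h2 => (hcuts p h1 h2).2
  have hblock : ∀ c i j, 4 ≤ c → (c + 1) % 4 = r → i < n → j < n →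
      (∃ k, (i, j) ∈ blockEdges (c + 4 * k)) → A j i = 1 := by
    rintro c i j hc hcr hi hj ⟨k, hk⟩
    obtain ⟨q, hq⟩ : ∃ q, q = c + 4 * k := ⟨_, rfl⟩
    rw [← hq] at hk
    have hqr : (q + 1) % 4 = r := by omega
    have hr13 : r = 1 ∨ r = 3 := by rw [hr]; split_ifs <;> simp
    have hb := fun hq2 : q + 2 ≤ n => hA.bridge_of_cuts (two q (by omega) (by omega) (by omega))
      (one (q + 1) (by omega) (by omega) hqr) (two (q + 2) (by omega) (by omega) (by omega))
    have hbl := fun hq5 : q + 5 ≤ n => hA.block_of_cuts (two q (by omega) (by omega) (by omega))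
      (one (q + 1) (by omega) (by omega) hqr) (two (q + 2) (by omega) (by omega) (by omega))
      (two (q + 4) (by omega) (by omega) (by omega))
      (one (q + 5) (by omega) (by omega) (by omega))
    simp only [blockEdges, List.mem_cons, Prod.mk.injEq, List.not_mem_nil, or_false] at hk
    -- the length `n` never cuts a block in two, only the bridge preceding it
    have hn4 : n % 4 = r ∨ n % 4 = (r + 1) % 4 := by rw [hr]; split_ifs <;> omega
    have h5 : q + 3 ≤ n → q + 5 ≤ n := by omega
    rcases hk with ⟨rfl, rfl⟩ | ⟨rfl, rfl⟩ | ⟨rfl, rfl⟩ | ⟨rfl, rfl⟩ | ⟨rfl, rfl⟩ | ⟨rfl, rfl⟩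
    · exact hb (by omega)
    · exact (hbl (by omega)).1
    · exact (hbl (by omega)).2.1
    · exact (hbl (by omega)).2.2.1
    · exact (hbl (by omega)).2.2.2.1
    · exact (hbl (by omega)).2.2.2.2
  have main : ∀ i j : ℕ, i < n → j < n →
      (if n % 4 = 1 ∨ n % 4 = 2 then (i, j) ∈ shortHead ∨ ∃ k, (i, j) ∈ blockEdges (4 + 4 * k)
        else (i, j) ∈ longHead ∨ ∃ k, (i, j) ∈ blockEdges (6 + 4 * k)) → A j i = 1 := by
    intro i j hi hj hij
    by_cases hs : n % 4 = 1 ∨ n % 4 = 2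
    · rw [if_pos hs] at hr hij
      rcases hij with hij | hij
      · have h4 := fun h5 : 5 ≤ n => hA.short_head_of_cuts h10 h20 h21 h30 h31
          (two 4 le_rfl (by omega) rfl) (one 5 (by omega) h5 hr.symm)
        rw [mem_shortHead_iff] at hij
        obtain ⟨rfl, rfl | rfl | rfl⟩ | ⟨rfl, rfl | rfl⟩ | ⟨rfl, rfl⟩ | ⟨rfl, rfl⟩ := hij
        exacts [h10, h20, h30, h21, h31, (h4 hj).1, (h4 hj).2]
      · exact hblock 4 i j le_rfl hr.symm hi hj hij
    · rw [if_neg hs] at hr hij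
      rcases hij with hij | hij
      · have h4 : 7 ≤ n → A 4 2 = 1 ∧ A 5 3 = 1 ∧ A 5 4 = 1 ∧ A 6 4 = 1 ∧ A 6 5 = 1 := by
          intro h7
          obtain ⟨e1, e2, e3, e4⟩ := hA.long_head_of_cuts h10 h20 h21 h30 h31
            (two 4 le_rfl (by omega) rfl) (two 6 (by omega) (by omega) rfl)
            (one 7 (by omega) h7 hr.symm)
          have e5 := hlong hr h7
          refine ⟨e5, ?_, e1, e2, e3⟩
          rcases e4 with e4 | e4
          · exact e4.2
          · have d := hA.nbrsBelow_le_three (p := 7) 4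
            simp only [nbrsBelow, Finset.sum_range_succ, Finset.sum_range_zero] at d
            have := hA.nonneg 4 0
            have := hA.nonneg 4 1
            have := hA.nonneg 4 4
            have := hA.symm 4 5
            have := hA.symm 4 6
            omega
        rw [mem_longHead_iff] at hij
        obtain ⟨rfl, rfl | rfl | rfl⟩ | ⟨rfl, rfl | rfl⟩ | ⟨rfl, rfl⟩ | ⟨rfl, rfl⟩ |
          ⟨rfl, rfl | rfl⟩ | ⟨rfl, rfl⟩ := hij
        · exact h10
        · exact h20
        · exact h30
        · exact h21
        · exact h31
        · exact (h4 (by omega)).1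
        · exact (h4 (by omega)).2.1
        · exact (h4 (by omega)).2.2.1
        · exact (h4 (by omega)).2.2.2.1
        · exact (h4 (by omega)).2.2.2.2
      · exact hblock 6 i j (by omega) hr.symm hi hj hij
  rw [extremalGraph, SimpleGraph.fromRel_adj] at h
  rcases h.2 with h | h
  · rw [hA.symm]
    exact main i j i.2 j.2 h
  · exact main j i j.2 i.2 h

/-- A subcubic graph that contains the extremal chain has no further edges: every vertex except the
last one already has degree `3`. -/
theorem IsSubcubicGraph.extremalGraph_adj_iff (hA : IsSubcubicGraph n A) (hn : 4 ≤ n)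
    (h32 : A 3 2 = 0) (hsub : ∀ i j : Fin n, (extremalGraph n).Adj i j → A i j = 1) (i j : Fin n) :
    (extremalGraph n).Adj i j ↔ A i j = 1 := by
  refine ⟨hsub i j, fun h => ?_⟩
  have hij : (i : ℕ) ≠ j := by
    intro h'
    rw [h', hA.diag] at h
    omega
  rcases hn.eq_or_lt with rfl | hn5
  · rw [extremalGraph_adj]
    have h23 : A 2 3 = 0 := by rw [hA.symm, h32]
    have hne : ¬ ((i : ℕ) = 2 ∧ (j : ℕ) = 3) := by
      rintro ⟨h1, h2⟩
      rw [h1, h2] at h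
      omega
    have hne' : ¬ ((i : ℕ) = 3 ∧ (j : ℕ) = 2) := by
      rintro ⟨h1, h2⟩
      rw [h1, h2] at h
      omega
    clear h hsub
    revert i j
    decide
  · have key : ∀ i j : Fin n, (i : ℕ) + 1 < n → A i j = 1 → (extremalGraph n).Adj i j := by
      intro i j hi h
      rw [extremalGraph_adj]
      by_contra hj
      have hlt := lt_of_mem_chainNbrs hn5 hi
      have h3 : ∑ k ∈ chainNbrs n i, A i k = 3 := by
        rw [Finset.sum_congr rfl fun k hk => hsub i ⟨k, hlt k hk⟩ (by rwa [extremalGraph_adj]),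
          Finset.sum_const, card_chainNbrs]
        rfl
      have h4 : ∑ k ∈ insert (j : ℕ) (chainNbrs n i), A i k ≤ ∑ k ∈ Finset.range n, A i k := by
        refine Finset.sum_le_sum_of_subset_of_nonneg (fun k hk => ?_) fun _ _ _ => hA.nonneg _ _
        rcases Finset.mem_insert.1 hk with rfl | hk
        · exact Finset.mem_range.2 j.2
        · exact Finset.mem_range.2 (hlt k hk)
      rw [Finset.sum_insert hj] at h4
      have := hA.deg_le i
      omega
    rcases lt_or_ge ((i : ℕ) + 1) n with hi | hi
    · exact key i j hi h
    · exact (key j i (by omega) (by rwa [hA.symm])).symm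

/-- A subcubic graph with the same bridges and the same even cuts as the extremal chain is the
extremal chain, up to a permutation of the first four vertices. -/
theorem IsSubcubicGraph.exists_perm_extremalGraph_adj_iff (hA : IsSubcubicGraph n A)
    (hcuts : HasChainCuts A r n) (hn : 4 ≤ n) (hr : r = if n % 4 = 1 ∨ n % 4 = 2 then 1 else 3) :
    ∃ σ : Equiv.Perm ℕ, (∀ i, 4 ≤ i → σ i = i) ∧
      ∀ i j : Fin n, (extremalGraph n).Adj i j ↔ A (σ i) (σ j) = 1 := by
  have two : ∀ p, 4 ≤ p → p ≤ n → p % 2 = 0 → cut A p = 2 := fun p h1 h2 => (hcuts p h1 h2).1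
  obtain ⟨σ, hσ, h10, h20, h21, h30, h31, h32⟩ := hA.exists_perm_head (two 4 le_rfl hn rfl)
  have hA' := hA.relabel hσ hn
  have hc' := hcuts.relabel hσ
  by_cases hlong : r = 3 → 7 ≤ n → A (σ 4) (σ 2) = 1
  · exact ⟨σ, hσ, hA'.extremalGraph_adj_iff hn h32 fun i j =>
      hA'.eq_one_of_extremalGraph_adj hc' hr h10 h20 h21 h30 h31 hlong⟩
  · push Not at hlong
    obtain ⟨hr3, h7, h42⟩ := hlong
    obtain ⟨-, -, -, he⟩ := hA'.long_head_of_cuts h10 h20 h21 h30 h31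
      ((hc' 4 le_rfl hn).1 rfl) ((hc' 6 (by omega) (by omega)).1 rfl)
      ((hc' 7 (by omega) h7).2 hr3.symm)
    have h43 : A (σ 4) (σ 3) = 1 := by
      rcases he with he | he
      · exact absurd he.1 h42
      · exact he.1
    have hτ : ∀ i, 4 ≤ i → Equiv.swap 2 3 i = i := fun i hi =>
      Equiv.swap_apply_of_ne_of_ne (by omega) (by omega)
    have hA'' := hA'.relabel hτ hn
    have hc'' := hc'.relabel hτ
    refine ⟨σ * Equiv.swap 2 3, fun i hi => ?_, hA''.extremalGraph_adj_iff hn ?_ fun i j =>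
      hA''.eq_one_of_extremalGraph_adj hc'' hr ?_ ?_ ?_ ?_ ?_ fun _ _ => ?_⟩
    · rw [Equiv.Perm.mul_apply, hτ i hi, hσ i hi]
    · show A (σ 2) (σ 3) = 0
      rw [hA.symm, h32]
    exacts [h10, h30, h31, h20, h21, h43]

end Structure

/-! ### Graphs with numbered vertices -/

section Labelled

variable {V : Type*} {n : ℕ}

open Classical in
/-- The adjacency function of a graph whose vertices are numbered by `e`, extended by `0`. -/
noncomputable def labelledAdj (G : SimpleGraph V) (e : V ≃ Fin n) (i j : ℕ) : ℤ :=
  if ∃ u v, G.Adj u v ∧ (e u : ℕ) = i ∧ (e v : ℕ) = j then 1 else 0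

/-- A function on the numbered vertices, extended by `0`. -/
def labelledFun (f : V → ℝ) (e : V ≃ Fin n) (i : ℕ) : ℝ :=
  if h : i < n then f (e.symm ⟨i, h⟩) else 0

theorem labelledAdj_apply (G : SimpleGraph V) [DecidableRel G.Adj] (e : V ≃ Fin n) (u v : V) :
    labelledAdj G e (e u) (e v) = if G.Adj u v then 1 else 0 := by
  classical
  refine if_congr ⟨?_, fun h => ⟨u, v, h, rfl, rfl⟩⟩ rfl rfl
  rintro ⟨u', v', h, hu, hv⟩
  rwa [e.injective (Fin.ext hu), e.injective (Fin.ext hv)] at h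

theorem labelledAdj_eq_one_iff (G : SimpleGraph V) (e : V ≃ Fin n) (u v : V) :
    labelledAdj G e (e u) (e v) = 1 ↔ G.Adj u v := by
  classical
  rw [labelledAdj_apply]
  split_ifs with h <;> simp [h]

theorem labelledFun_apply (f : V → ℝ) (e : V ≃ Fin n) (v : V) : labelledFun f e (e v) = f v := by
  simp [labelledFun]

theorem exists_eq_of_lt (e : V ≃ Fin n) {i : ℕ} (hi : i < n) : ∃ v, (e v : ℕ) = i :=
  ⟨e.symm ⟨i, hi⟩, by simp⟩

theorem labelledFun_antitone {f : V → ℝ} (hf : ∀ v, 0 < f v) {e : V ≃ Fin n}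
    (he : Antitone (f ∘ e.symm)) : Antitone (labelledFun f e) := by
  intro i j hij
  unfold labelledFun
  split_ifs with h1 h2 h2
  · exact he (show (⟨i, h2⟩ : Fin n) ≤ ⟨j, h1⟩ from hij)
  · omega
  · exact (hf _).le
  · exact le_rfl

variable [Fintype V]

theorem sum_range_eq_sum_labels {M : Type*} [AddCommMonoid M] (e : V ≃ Fin n) (g : ℕ → M) :
    ∑ i ∈ Finset.range n, g i = ∑ v, g (e v) := by
  rw [Finset.sum_range, ← Equiv.sum_comp e]

theorem exists_antitone_labelling (hV : Fintype.card V = n) (f : V → ℝ) :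
    ∃ e : V ≃ Fin n, Antitone (f ∘ e.symm) := by
  let e₀ := Fintype.equivFinOfCardEq hV
  refine ⟨e₀.trans (Tuple.sort fun i => -f (e₀.symm i)).symm, fun i j hij => ?_⟩
  have h := Tuple.monotone_sort (fun i => -f (e₀.symm i)) hij
  exact neg_le_neg_iff.1 h

theorem IsConnectedNonregular.degree_le {G : SimpleGraph V} [DecidableRel G.Adj] {d : ℕ}
    (hG : IsConnectedNonregular d G) (v : V) : G.degree v ≤ d := by
  classical
  unfold IsConnectedNonregular at hG
  rw [← hG.2.2]
  convert G.degree_le_maxDegree v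

theorem IsConnectedNonregular.connected {G : SimpleGraph V} {d : ℕ}
    (hG : IsConnectedNonregular d G) : G.Connected := by
  unfold IsConnectedNonregular at hG
  exact hG.1

theorem IsConnectedNonregular.exists_degree_ne {G : SimpleGraph V} [DecidableRel G.Adj] {d : ℕ}
    (hG : IsConnectedNonregular d G) (k : ℕ) : ∃ v, G.degree v ≠ k := by
  classical
  by_contra! h
  unfold IsConnectedNonregular at hG
  refine hG.2.1 ⟨k, fun v => ?_⟩
  convert h v

theorem sum_labelledAdj (G : SimpleGraph V) [DecidableRel G.Adj] (e : V ≃ Fin n) (u : V) :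
    ∑ j ∈ Finset.range n, labelledAdj G e (e u) j = G.degree u := by
  rw [sum_range_eq_sum_labels e]
  simp only [labelledAdj_apply]
  rw [Finset.sum_boole, ← SimpleGraph.card_neighborFinset_eq_degree,
    SimpleGraph.neighborFinset_eq_filter]

/-- An initial segment all of whose vertices have three neighbours inside it would be the whole
vertex set by connectedness, and the graph would be regular. -/
theorem isSubcubicNetwork_labelledAdj {G : SimpleGraph V} (hG : IsConnectedNonregular 3 G)
    (e : V ≃ Fin n) : IsSubcubicNetwork n (labelledAdj G e) := by
  classical
  have hsub : IsSubcubicGraph n (labelledAdj G e) :=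
    { symm := fun i j => by
        unfold labelledAdj
        congr 1
        exact propext ⟨fun ⟨u, v, h, hu, hv⟩ => ⟨v, u, h.symm, hv, hu⟩,
          fun ⟨u, v, h, hu, hv⟩ => ⟨v, u, h.symm, hv, hu⟩⟩
      zero_or_one := fun i j => by
        unfold labelledAdj
        split_ifs <;> simp
      diag := fun i => by
        unfold labelledAdj
        rw [if_neg]
        rintro ⟨u, v, h, hu, hv⟩
        exact h.ne (e.injective (Fin.ext (hu.trans hv.symm)))
      supp := fun i j hj => by
        unfold labelledAdj
        rw [if_neg]
        rintro ⟨u, v, h, hu, hv⟩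
        have := (e v).2
        omega
      deg_le := fun i => by
        rcases lt_or_ge i n with hi | hi
        · obtain ⟨u, rfl⟩ := exists_eq_of_lt e hi
          rw [sum_labelledAdj]
          exact_mod_cast hG.degree_le u
        · rw [Finset.sum_eq_zero]
          · norm_num
          · intro j _
            unfold labelledAdj
            rw [if_neg]
            rintro ⟨u, v, h, hu, hv⟩
            have := (e u).2
            omega }
  refine { hsub with exists_open := fun p hp hpn => ?_ }
  by_contra! hfull
  -- the initial segment is closed under adjacency, hence it is everything
  have hstep : ∀ u v, G.Adj u v → (e u : ℕ) < p → (e v : ℕ) < p := by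
    intro u v huv hu
    by_contra hv
    have h1 : ∑ j ∈ insert (e v : ℕ) (Finset.range p), labelledAdj G e (e u) j
        ≤ ∑ j ∈ Finset.range n, labelledAdj G e (e u) j := by
      refine Finset.sum_le_sum_of_subset_of_nonneg (fun j hj => ?_) fun _ _ _ => hsub.nonneg _ _
      rcases Finset.mem_insert.1 hj with rfl | hj
      · exact Finset.mem_range.2 (e v).2
      · have := Finset.mem_range.1 hj
        exact Finset.mem_range.2 (by omega)
    rw [Finset.sum_insert (by simpa using hv), hfull _ hu, (labelledAdj_eq_one_iff G e u v).2 huv]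
      at h1
    have := hsub.deg_le (e u)
    omega
  have hall : ∀ v, (e v : ℕ) < p := by
    intro v
    obtain ⟨u, hu⟩ := exists_eq_of_lt e (show 0 < n by omega)
    have hu' : (e u : ℕ) < p := by omega
    obtain ⟨w⟩ := hG.connected.preconnected u v
    clear hu
    induction w with
    | nil => exact hu'
    | cons hadj _ ih => exact ih (hstep _ _ hadj hu')
  obtain ⟨v, hv⟩ := hG.exists_degree_ne 3
  have h1 := hfull _ (hall v)
  have h2 := hsub.nbrsBelow_mono hpn (e v)
  have h3 := sum_labelledAdj G e v
  have h4 := hG.degree_le v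
  unfold nbrsBelow at h2
  omega

theorem isSortedSubsolution_labelledFun {G : SimpleGraph V} [DecidableRel G.Adj] {f : V → ℝ}
    {μ : ℝ} (hf : ∀ v, 0 < f v)
    (hμ : ∀ v, (3 - μ) * f v ≤ ∑ u, (if G.Adj v u then f u else 0)) {e : V ≃ Fin n}
    (he : Antitone (f ∘ e.symm)) :
    IsSortedSubsolution n (labelledAdj G e) μ (labelledFun f e) where
  antitone := labelledFun_antitone hf he
  pos i hi := by
    obtain ⟨v, rfl⟩ := exists_eq_of_lt e hi
    rw [labelledFun_apply]
    exact hf v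
  zero i hi := dif_neg (by omega)
  le_sum i hi := by
    obtain ⟨v, rfl⟩ := exists_eq_of_lt e hi
    rw [sum_range_eq_sum_labels e, labelledFun_apply]
    refine (hμ v).trans_eq (Finset.sum_congr rfl fun u _ => ?_)
    rw [labelledAdj_apply, labelledFun_apply]
    split_ifs <;> simp

end Labelled

theorem isChainEigenvector_labelledFun {n : ℕ} {f : Fin n → ℝ} {μ : ℝ}
    [DecidableRel (extremalGraph n).Adj] (hf : ∀ v, 0 < f v)
    (hμ : ∀ v, ∑ u, (if (extremalGraph n).Adj v u then f u else 0) = (3 - μ) * f v) :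
    IsChainEigenvector n μ (labelledFun f (Equiv.refl (Fin n))) where
  pos i hi := by
    rw [labelledFun, dif_pos hi]
    exact hf _
  zero i hi := dif_neg (by omega)
  eigen i hi := by
    set h := labelledFun f (Equiv.refl (Fin n)) with hh
    have hval : ∀ v : Fin n, h v = f v := labelledFun_apply f (Equiv.refl _)
    have h1 : ∑ j ∈ chainNbrs n i, h j 
        = ∑ j ∈ Finset.range n, if j ∈ chainNbrs n i then h j else 0 := by
      rw [← Finset.sum_filter, Finset.filter_mem_eq_inter, Finset.inter_comm,
        ← Finset.filter_mem_eq_inter, Finset.sum_filter]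
      refine Finset.sum_congr rfl fun j _ => ?_
      split_ifs with hj
      · rfl
      · exact dif_neg (by simpa using hj)
    rw [h1, Finset.sum_range, hval ⟨i, hi⟩, ← hμ]
    refine Finset.sum_congr rfl fun j _ => ?_
    rw [hval]
    exact if_congr (extremalGraph_adj _ _) rfl rfl

/-- Testing the Rayleigh quotient on the constant vector. -/
theorem sum_degree_le_card_mul_graphSpectralRadius {V : Type*} [Fintype V] [Nonempty V]
    (G : SimpleGraph V) [DecidableRel G.Adj] :
    ((∑ v, G.degree v : ℕ) : ℝ) ≤ Fintype.card V * graphSpectralRadius G := by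
  classical
  have h := dotProduct_adjMatrix_mulVec_le G fun _ => 1
  have h1 : (fun _ : V => (1 : ℝ)) ⬝ᵥ (G.adjMatrix ℝ).mulVec (fun _ => 1)
      = ((∑ v, G.degree v : ℕ) : ℝ) := by
    simp [dotProduct, Matrix.mulVec, SimpleGraph.adjMatrix_apply, Finset.sum_boole,
      ← SimpleGraph.card_neighborFinset_eq_degree, SimpleGraph.neighborFinset_eq_filter]
  rw [h1] at h
  simpa [dotProduct, mul_comm] using h

/-! ### Maximality of the extremal chain -/

/-- A competitor whose spectral radius is not smaller than that of the extremal chain is isomorphic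
to it. -/
theorem nonempty_iso_extremalGraph {n : ℕ} (hn : 4 ≤ n) {V : Type*} [Fintype V]
    {G : SimpleGraph V} (hV : Fintype.card V = n) (hG : IsConnectedNonregular 3 G)
    (hle : graphSpectralRadius (extremalGraph n) ≤ graphSpectralRadius G) :
    Nonempty (G ≃g extremalGraph n) := by
  classical
  obtain ⟨r, hr⟩ : ∃ r, r = if n % 4 = 1 ∨ n % 4 = 2 then 1 else 3 := ⟨_, rfl⟩
  obtain ⟨μ, hμ⟩ : ∃ μ, μ = 3 - graphSpectralRadius (extremalGraph n) := ⟨_, rfl⟩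
  have hn0 : (4 : ℝ) ≤ n := by exact_mod_cast hn
  -- Bounds for `μ` from the number of edges of the chain.
  have hsum : (3 : ℝ) * n ≤ n * graphSpectralRadius (extremalGraph n)
      + (if n % 2 = 1 then 1 else 2) := by
    have : Nonempty (Fin n) := ⟨⟨0, by omega⟩⟩
    have h1 := sum_degree_le_card_mul_graphSpectralRadius (extremalGraph n)
    have h2 : ((3 * n : ℕ) : ℝ) ≤ ((∑ v, (extremalGraph n).degree v
        + (if n % 2 = 1 then 1 else 2) : ℕ) : ℝ) := by
      exact_mod_cast sum_degree_extremalGraph hn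
    rw [Fintype.card_fin] at h1
    rw [Nat.cast_add] at h2
    push_cast at h1 h2
    linarith
  have hμ2 : n * μ ≤ 2 := by
    rw [hμ]
    split_ifs at hsum <;> linarith
  have hμ1 : n % 2 = 1 → n * μ ≤ 1 := fun hodd => by
    rw [if_pos hodd] at hsum
    rw [hμ]
    linarith
  have hμ_half : μ ≤ 1 / 2 := by nlinarith
  -- The Perron vector of the chain provides the ratios to compare with.
  obtain ⟨h, hpos, heig⟩ := exists_perron_vector (extremalGraph n) (extremalGraph_connected hn)
  have H : IsChainEigenvector n μ (labelledFun h (Equiv.refl (Fin n))) :=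
    isChainEigenvector_labelledFun hpos fun v => by rw [heig, hμ, sub_sub_cancel]
  have hF := H.isChainFlux hn hr hμ_half
  have hμ0 := hF.mu_pos hn hr H.pos H.zero
  have hT := hF.isChainRatio hn hr (by linarith) H.pos H.zero
  -- The Perron vector of the competitor, sorted.
  obtain ⟨f, hfpos, hfeig⟩ := exists_perron_vector G hG.connected
  obtain ⟨e, he⟩ := exists_antitone_labelling hV f
  have hf : IsSortedSubsolution n (labelledAdj G e) μ (labelledFun f e) :=
    isSortedSubsolution_labelledFun hfpos (fun v => by
      rw [hfeig, hμ, sub_sub_cancel]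
      exact mul_le_mul_of_nonneg_right hle (hfpos v).le) he
  have hA := isSubcubicNetwork_labelledAdj hG e
  have hcuts := hf.hasChainCuts hA hT hn hr hμ0 hμ2 hμ1
  obtain ⟨σ, hσ, hiff⟩ := hA.toIsSubcubicGraph.exists_perm_extremalGraph_adj_iff hcuts hn hr
  let τ : Fin n ≃ Fin n :=
    { toFun := fun i => ⟨σ i, (perm_lt_iff_of_fixes hσ hn i).2 i.2⟩
      invFun := fun i => ⟨σ.symm i, (perm_lt_iff_of_fixes hσ hn _).1 (by simp)⟩
      left_inv := fun i => by simp
      right_inv := fun i => by simp }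
  refine ⟨SimpleGraph.Iso.symm ⟨τ.trans e.symm, fun {i j} => ?_⟩⟩
  rw [hiff, ← labelledAdj_eq_one_iff G e]
  simp [τ]

/-- For `n ≥ 4`, the graph `extremalGraph n` is, up to isomorphism, the unique graph of maximum
spectral radius among all connected nonregular graphs with `n` vertices and maximum degree `3`. -/
theorem mainTheorem4 (n : ℕ) (hn : 4 ≤ n) :
    IsConnectedNonregular 3 (extremalGraph n) ∧
    ∀ (V : Type*) [Fintype V] (G : SimpleGraph V),
      Fintype.card V = n → IsConnectedNonregular 3 G →
        graphSpectralRadius G ≤ graphSpectralRadius (extremalGraph n) ∧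
        (graphSpectralRadius G = graphSpectralRadius (extremalGraph n) ↔
          Nonempty (G ≃g extremalGraph n)) := by
  refine ⟨isConnectedNonregular_extremalGraph hn, fun V _ G hV hG => ⟨?_, ?_, ?_⟩⟩
  · by_contra! hlt
    obtain ⟨e⟩ := nonempty_iso_extremalGraph hn hV hG hlt.le
    exact hlt.ne' (graphSpectralRadius_congr e)
  · exact fun h => nonempty_iso_extremalGraph hn hV hG h.ge
  · rintro ⟨e⟩
    exact graphSpectralRadius_congr e
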